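/- Setting. Let $\dot A$ be a closed, densely defined, symmetric operator with equal finite deficiency indices in a complex Hilbert space $\mathcal H$, and let $\mathcal H_+\subset\mathcal H\subset\mathcal H_-$ be the rigged Hilbert space with $\mathcal H_+=\mathrm{dom}(\dot A^*)$, $(f,g)_+=(f,g)+(\dot A^*f,\dot A^*g)$. An L-system $\Theta$ with input-output space $\mathbb C$ and direction operator $J=1$ consists of $\mathbb A\in[\mathcal H_+,\mathcal H_-]$ and $K\in[\mathbb C,\mathcal H_-]$ such that: - $T$ (the main operator) is a non-symmetric operator with $\dot A\subset T\subset\dot A^*$, $\rho(T)\neq\emptyset$ and $\mathrm{dom}\,\dot A=\mathrm{dom}\,T\cap\mathrm{dom}\,T^*$; - $\mathbb A$ is a $(*)$-extension of $T$, i.e. $\mathbb A\supset T$, $\mathbb A^*\supset T^*$, and $\mathrm{Re}\,\mathbb A$ has a self-adjoint quasi-kernel $\hat A$, the restriction of $\mathrm{Re}\,\mathbb A$ to $\{f\in\mathcal H_+:\mathrm{Re}\,\mathbb A f\in\mathcal H\}$; - $\mathrm{Im}\,\mathbb A=KK^*$ and $\mathrm{ran}\,K=\mathrm{ran}\,\mathrm{Im}\,\mathbb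 A$. It is minimal if no non-zero closed subspace reduces $\dot A$ to a self-adjoint operator. Put $$W_\Theta(z)=1-2iK^*(\mathbb A-zI)^{-1}K\ (z\in\rho(T)),\qquad V_\Theta(z)=K^*(\mathrm{Re}\,\mathbb A-zI)^{-1}K\ (z\in\rho(\hat A)),$$ the transfer function and the impedance function. An L-system $\Theta'$ of this kind, possibly in another Hilbert space and with main operator $T'$, is a unimodular transformation of $\Theta$ with parameter $\alpha\in[0,\pi)$ if $W_{\Theta'}(z)=W_\Theta(z)\,(-e^{2i\alpha})$ for $z\in\rho(T)\cap\rho(T')$. For real $Q$ and $0\le\kappa<1$ let $\mathfrak M^{Q}$, $\mathfrak M^{Q}_\kappa$, $\mathfrak M^{-1,Q}_\kappa$ be the classes of functions on the open upper half-plane of the form $$V(z)=Q+\int_{\mathbb R}\Big(\frac1{\lambda-z}-\frac{\lambda}{1+\lambda^2}\Big)d\mu(\lambda)$$ with an infinite Borel measure $\mu$ such that $\int_{\mathbb R}\frac{d\mu(\lambda)}{1+\lambda^2}$ equals $1$, $\frac{1-\kappa}{1+\kappa}$, $\frac{1+\kappa}{1-\kappa}$, respectively. Corollary. Let $\Theta$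 be a minimal L-system as above, let $Q\neq0$ be real and $0\le\kappa<1$. If $V_\Theta$ belongs to $\mathfrak M^{Q}$ (respectively $\mathfrak M^{Q}_\kappa$, $\mathfrak M^{-1,Q}_\kappa$), then there is a unique unimodular transformation $\Theta_\alpha$ of $\Theta$ whose impedance function belongs to $\mathfrak M^{-Q}$ (respectively $\mathfrak M^{-Q}_\kappa$, $\mathfrak M^{-1,-Q}_\kappa$), in the following sense. There is exactly one $\alpha\in[0,\pi)$ for which some unimodular transformation of $\Theta$ with parameter $\alpha$ has its impedance function in this class; every unimodular transformation of $\Theta$ with this parameter $\alpha$ has its impedance function in this class; and there is a minimal one with the same operator $\dot A$ and the same main operator $T$ as $\Theta$, in which $\mathbb A_\alpha$ is unique and $K_\alpha$ is unique up to a unimodular constant factor. If $0<\kappa<1$, the classes $\mathfrak M^{-Q}$, $\mathfrak M^{-Q}_\kappa$, $\mathfrak M^{-1,-Q}_\kappa$ are pairwise disjoint, so that $V_{\Theta_\alpha}$ belongs to exactly one of them. -/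

import Mathlib

set_option maxSynthPendingDepth 3

open scoped LinearPMap ComplexConjugate

universe u v

noncomputable section

namespace LSys

variable {H : Type u} [NormedAddCommGroup H] [InnerProductSpace ℂ H] [CompleteSpace H]

/-! ### Unbounded operators: inner products are antilinear in the first slot, so that the
`(f, g)` of the mathematical literature is `inner ℂ g f`. -/

/-- The resolvent set of an unbounded operator: `T - zI` maps `dom T` bijectively onto `H` and has
a bounded inverse `R`. -/
def resolventSet (T : H →ₗ.[ℂ] H) : Set ℂ :=
  {z | ∃ R : H →L[ℂ] H,
    (∀ h : H, ∃ x : T.domain, (x : H) = R h ∧ T x - z • (x : H) = h) ∧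
    ∀ x : T.domain, R (T x - z • (x : H)) = x}

/-- The deficiency subspace `Ker (A* - zI)`. -/
def deficiencySpace (A : H →ₗ.[ℂ] H) (z : ℂ) : Submodule ℂ A†.domain :=
  LinearMap.ker (A†.toFun - z • A†.domain.subtype)

/-- `A` is a closed, densely defined, symmetric operator with equal finite deficiency indices. -/
structure IsSymmOp (A : H →ₗ.[ℂ] H) : Prop where
  closed : A.IsClosed
  dense : Dense (A.domain : Set H)
  symm : A.IsFormalAdjoint A
  finite_pos : FiniteDimensional ℂ (deficiencySpace A Complex.I)
  finite_neg : FiniteDimensional ℂ (deficiencySpace A (-Complex.I))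
  index_eq : Module.finrank ℂ (deficiencySpace A Complex.I) =
    Module.finrank ℂ (deficiencySpace A (-Complex.I))

/-- The operator in `M` induced by `A`: its domain is `{x ∈ M ∩ dom A | A x ∈ M}`. -/
def part (A : H →ₗ.[ℂ] H) (M : Submodule ℂ H) : M →ₗ.[ℂ] M :=
  (A.graph.comap (M.subtype.prodMap M.subtype)).toLinearPMap

/-- The closed subspace `M` reduces `A`: `P_M A ⊆ A P_M` for the orthogonal projection `P_M`. -/
def Reduces (A : H →ₗ.[ℂ] H) (M : Submodule ℂ H) [CompleteSpace M] : Prop :=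
  ∀ x y : H, (x, y) ∈ A.graph → (M.starProjection x, M.starProjection y) ∈ A.graph

/-- `A` is prime: no non-zero reducing closed subspace on which `A` induces a self-adjoint
operator. -/
def IsPrimeOp (A : H →ₗ.[ℂ] H) : Prop :=
  ∀ (M : Submodule ℂ H) [CompleteSpace M], Reduces A M → IsSelfAdjoint (part A M) → M = ⊥

/-! ### The rigged Hilbert space `H₊ ⊂ H ⊂ H₋` -/

/-- `H₊ = dom A*` with the inner product `(f, g)₊ = (f, g) + (A* f, A* g)`, realized as the graph
`{(f, A* f) | f ∈ dom A*}` in the Hilbert sum `H ⊕ H`. -/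
abbrev HPlus (A : H →ₗ.[ℂ] H) : Submodule ℂ (WithLp 2 (H × H)) :=
  A†.graph.comap (WithLp.linearEquiv 2 ℂ (H × H)).toLinearMap

/-- The bounded inclusion `H₊ → H`. -/
def HPlus.incl (A : H →ₗ.[ℂ] H) : HPlus A →L[ℂ] H :=
  (WithLp.fstL 2 ℂ H H).comp (HPlus A).subtypeL

/-- `A*` as a bounded operator `H₊ → H`. -/
def HPlus.star (A : H →ₗ.[ℂ] H) : HPlus A →L[ℂ] H :=
  (WithLp.sndL 2 ℂ H H).comp (HPlus A).subtypeL

theorem HPlus.mem_graph (A : H →ₗ.[ℂ] H) (f : HPlus A) :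
    (HPlus.incl A f, HPlus.star A f) ∈ A†.graph := f.2

theorem HPlus.range_incl (A : H →ₗ.[ℂ] H) :
    Set.range (HPlus.incl A) = (A†.domain : Set H) := by
  ext x
  constructor
  · rintro ⟨f, rfl⟩
    exact LinearPMap.mem_domain_of_mem_graph (HPlus.mem_graph A f)
  · intro hx
    exact ⟨⟨WithLp.toLp 2 (x, A† ⟨x, hx⟩), A†.mem_graph ⟨x, hx⟩⟩, rfl⟩

theorem HPlus.star_eq (A : H →ₗ.[ℂ] H) (f : HPlus A) (x : A†.domain)
    (h : HPlus.incl A f = x) : HPlus.star A f = A† x := by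
  have h1 := HPlus.mem_graph A f
  rw [h] at h1
  exact LinearPMap.mem_graph_snd_inj _ h1 (A†.mem_graph x) rfl

theorem HPlus.inner_def (A : H →ₗ.[ℂ] H) (f g : HPlus A) :
    inner ℂ f g = inner ℂ (HPlus.incl A f) (HPlus.incl A g) +
      inner ℂ (HPlus.star A f) (HPlus.star A g) :=
  WithLp.prod_inner_apply _ _

theorem HPlus.incl_injective (A : H →ₗ.[ℂ] H) : Function.Injective (HPlus.incl A) := by
  rw [injective_iff_map_eq_zero]
  intro f hf
  have h := HPlus.inner_def A f f
  rw [HPlus.star_eq A f 0 (by simpa using hf), hf] at h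
  simpa using h

/-- `H₋`: the bounded antilinear functionals on `H₊`; `g f` is the pairing `(g, f)`. -/
abbrev HMinus (A : H →ₗ.[ℂ] H) : Type u := HPlus A →L⋆[ℂ] ℂ

/-- The embedding `H → H₋`, `h ↦ (f ↦ (h, f))`. -/
def emb (A : H →ₗ.[ℂ] H) : H →ₗ[ℂ] HMinus A where
  toFun h := (innerSLFlip ℂ h).comp (HPlus.incl A)
  map_add' x y := by ext f; simp
  map_smul' c x := by ext f; simp

/-- The adjoint `S* ∈ [H₊, H₋]` of `S ∈ [H₊, H₋]`: `(S* f, g) = conj (S g, f)`. -/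
def adj {A : H →ₗ.[ℂ] H} (S : HPlus A →L[ℂ] HMinus A) : HPlus A →L[ℂ] HMinus A :=
  LinearMap.mkContinuous₂
    (LinearMap.mk₂'ₛₗ (RingHom.id ℂ) (starRingEnd ℂ) (fun f g => conj (S g f))
      (fun f₁ f₂ g => by simp) (fun c f g => by simp) (fun f g₁ g₂ => by simp)
      (fun c f g => by simp)) ‖S‖
    (fun f g => by
      simp only [LinearMap.mk₂'ₛₗ_apply, RCLike.norm_conj]
      calc ‖S g f‖ ≤ ‖S‖ * ‖g‖ * ‖f‖ := S.le_opNorm₂ g f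
        _ = ‖S‖ * ‖f‖ * ‖g‖ := by ring)

theorem adj_apply {A : H →ₗ.[ℂ] H} (S : HPlus A →L[ℂ] HMinus A) (f g : HPlus A) :
    adj S f g = conj (S g f) := rfl

/-- `Re S = (S + S*) / 2`. -/
def rePart {A : H →ₗ.[ℂ] H} (S : HPlus A →L[ℂ] HMinus A) : HPlus A →L[ℂ] HMinus A :=
  (1 / 2 : ℂ) • (S + adj S)

/-- `Im S = (S - S*) / (2i)`. -/
def imPart {A : H →ₗ.[ℂ] H} (S : HPlus A →L[ℂ] HMinus A) : HPlus A →L[ℂ] HMinus A :=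
  (1 / (2 * Complex.I) : ℂ) • (S - adj S)

/-- `S ⊃ B`, for `S ∈ [H₊, H₋]` and an operator `B` in `H`. -/
def Extends {A : H →ₗ.[ℂ] H} (S : HPlus A →L[ℂ] HMinus A) (B : H →ₗ.[ℂ] H) : Prop :=
  ∀ x : B.domain, ∃ f : HPlus A, HPlus.incl A f = x ∧ S f = emb A (B x)

/-- The quasi-kernel of `S`: the operator in `H` with domain `{f ∈ H₊ | S f ∈ H}` that acts
as `S`. -/
def quasiKernel {A : H →ₗ.[ℂ] H} (S : HPlus A →L[ℂ] HMinus A) : H →ₗ.[ℂ] H :=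
  (((LinearMap.eqLocus (S.toLinearMap.comp (LinearMap.fst ℂ (HPlus A) H))
      ((emb A).comp (LinearMap.snd ℂ (HPlus A) H))).map
        ((HPlus.incl A).toLinearMap.prodMap LinearMap.id) : Submodule ℂ (H × H))).toLinearPMap

/-! ### Extensions -/

/-- `T` is a quasi-self-adjoint extension of `A`: non-symmetric with `A ⊂ T ⊂ A*`. -/
structure IsQuasiSelfAdjointExt (A T : H →ₗ.[ℂ] H) : Prop where
  le : A ≤ T
  le_adjoint : T ≤ A†
  not_symm : ¬ T.IsFormalAdjoint T

/-- The class `Λ(A)`. -/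
structure MemLambda (A T : H →ₗ.[ℂ] H) : Prop where
  quasi : IsQuasiSelfAdjointExt A T
  resolvent : (resolventSet T).Nonempty
  domain_eq : A.domain = T.domain ⊓ T†.domain

/-- `S` is a `t`-self-adjoint bi-extension of `A`. -/
structure IsTSelfAdjointBiExt {A : H →ₗ.[ℂ] H} (S : HPlus A →L[ℂ] HMinus A) : Prop where
  adj_eq : adj S = S
  ext : Extends S A
  quasiKernel_selfAdjoint : IsSelfAdjoint (quasiKernel S)

/-- `S` is a quasi-self-adjoint bi-extension of `T`. -/
structure IsQuasiBiExt {A : H →ₗ.[ℂ] H} (T : H →ₗ.[ℂ] H) (S : HPlus A →L[ℂ] HMinus A) :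
    Prop where
  ext : Extends S T
  ext_adj : Extends (adj S) T†

/-- `S` is a `(*)`-extension of `T`. -/
structure IsStarExt {A : H →ₗ.[ℂ] H} (T : H →ₗ.[ℂ] H) (S : HPlus A →L[ℂ] HMinus A) :
    Prop where
  quasi : IsQuasiSelfAdjointExt A T
  resolvent : (resolventSet T).Nonempty
  biExt : IsQuasiBiExt T S
  re : IsTSelfAdjointBiExt (rePart S)

/-! ### L-systems with input-output space `ℂ` and direction operator `J = 1` -/

/-- The adjoint `K* ∈ [H₊, ℂ]` of `K ∈ [ℂ, H₋]`: `(K* f, e) = (f, K e) = conj (K e, f)`. -/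
def chanAdj {A : H →ₗ.[ℂ] H} (K : ℂ →L[ℂ] HMinus A) : HPlus A →L[ℂ] ℂ :=
  ((InnerProductSpace.toDual ℂ ℂ).symm.toContinuousLinearEquiv.toContinuousLinearMap :
    (ℂ →L[ℂ] ℂ) →L⋆[ℂ] ℂ).comp K.flip

theorem inner_chanAdj {A : H →ₗ.[ℂ] H} (K : ℂ →L[ℂ] HMinus A) (f : HPlus A) (e : ℂ) :
    inner ℂ (chanAdj K f) e = K e f := by
  simp only [chanAdj, ContinuousLinearMap.comp_apply]
  exact InnerProductSpace.toDual_symm_apply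

/-- An L-system with input-output space `ℂ` and direction operator `J = 1` (a scattering system),
built on the symmetric operator `A`; `T` is the main operator, `S` the state-space operator and
`K` the channel operator. -/
structure ScalarLSystem (A : H →ₗ.[ℂ] H) where
  T : H →ₗ.[ℂ] H
  S : HPlus A →L[ℂ] HMinus A
  K : ℂ →L[ℂ] HMinus A
  isSymmOp : IsSymmOp A
  memLambda : MemLambda A T
  isStarExt : IsStarExt T S
  imPart_eq : imPart S = K.comp (chanAdj K)
  range_eq : Set.range K = Set.range (imPart S)

/-- `(S - zI)⁻¹ g ∈ H₊`, for `g` in the range of an injective `S - zI : H₊ → H₋`. In the two uses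
below `S - zI` is injective and its range contains `H` and the range of `K`. -/
def applyInv {A : H →ₗ.[ℂ] H} (S : HPlus A →L[ℂ] HMinus A) (z : ℂ) (g : HMinus A) : HPlus A :=
  Function.invFun (fun f : HPlus A => S f - z • emb A (HPlus.incl A f)) g

namespace ScalarLSystem

variable {A : H →ₗ.[ℂ] H} (Θ : ScalarLSystem A)

/-- The system is minimal: the symmetric operator is prime. -/
def IsMinimal (_ : ScalarLSystem A) : Prop := IsPrimeOp A

/-- The transfer function `W(z) = 1 - 2i K* (S - zI)⁻¹ K`, for `z ∈ ρ(T)`. -/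
def transfer (z : ℂ) : ℂ := 1 - 2 * Complex.I * chanAdj Θ.K (applyInv Θ.S z (Θ.K 1))

/-- The impedance function `V(z) = K* (Re S - zI)⁻¹ K`, for `z` in the resolvent set of the
quasi-kernel of `Re S`. -/
def impedance (z : ℂ) : ℂ := chanAdj Θ.K (applyInv (rePart Θ.S) z (Θ.K 1))

/-- `Θ'` is a unimodular transformation of `Θ` with parameter `α ∈ [0, π)`:
`W_{Θ'}(z) = W_Θ(z) (-e^{2iα})`. The two systems may live in different spaces. -/
def IsUnimodularTransformation {H' : Type v} [NormedAddCommGroup H'] [InnerProductSpace ℂ H']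
    [CompleteSpace H'] {A' : H' →ₗ.[ℂ] H'} (α : ℝ) (Θ' : ScalarLSystem A') : Prop :=
  α ∈ Set.Ico 0 Real.pi ∧ ∀ z ∈ resolventSet Θ.T ∩ resolventSet Θ'.T,
    Θ'.transfer z = Θ.transfer z * (-Complex.exp (2 * Complex.I * α))

end ScalarLSystem

/-! ### Perturbed Donoghue classes -/

/-- The functions on the upper half-plane of the form
`V(z) = Q + ∫ (1 / (t - z) - t / (1 + t²)) dμ(t)`, with an infinite Borel measure `μ` such that
`∫ dμ(t) / (1 + t²) = a`. (Such a function is automatically Herglotz-Nevanlinna.) -/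
def donoghue (Q a : ℝ) : Set (ℂ → ℂ) :=
  {V | ∃ μ : MeasureTheory.Measure ℝ, μ Set.univ = ⊤ ∧
    MeasureTheory.Integrable (fun t : ℝ => 1 / (1 + t ^ 2)) μ ∧
    ∫ t : ℝ, 1 / (1 + t ^ 2) ∂μ = a ∧
    ∀ z : ℂ, 0 < z.im →
      V z = Q + ∫ t : ℝ, (1 / ((t : ℂ) - z) - (t : ℂ) / (1 + (t : ℂ) ^ 2)) ∂μ}

/-- The class `𝔐^Q`. -/
def classM (Q : ℝ) : Set (ℂ → ℂ) := donoghue Q 1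

/-- The class `𝔐^Q_κ`, `0 ≤ κ < 1`. -/
def classMk (κ Q : ℝ) : Set (ℂ → ℂ) := donoghue Q ((1 - κ) / (1 + κ))

/-- The class `𝔐^{-1,Q}_κ`, `0 ≤ κ < 1`. -/
def classMkInv (κ Q : ℝ) : Set (ℂ → ℂ) := donoghue Q ((1 + κ) / (1 - κ))

/-- There is exactly one unimodular transformation of `Θ` whose impedance function is in the
class `C`. Existence: for some `α` there is such a transformation that acts in the same spaces and
has the same main operator, and every unimodular transformation with this `α` has its impedance
function in `C`. Uniqueness: `α` is unique among the parameters of all unimodular transformations,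
in whatever space, with impedance function in `C`; and the transformation with the given main
operator is unique up to a unimodular constant factor of the channel operator. -/
def HasUniqueUnimodularTransformation {A : H →ₗ.[ℂ] H} (Θ : ScalarLSystem A)
    (C : Set (ℂ → ℂ)) : Prop :=
  ∃ α ∈ Set.Ico 0 Real.pi,
    (∃ Θ' : ScalarLSystem A, Θ'.T = Θ.T ∧ Θ'.IsMinimal ∧
      Θ.IsUnimodularTransformation α Θ' ∧ Θ'.impedance ∈ C) ∧
    (∀ (H' : Type v) [NormedAddCommGroup H'] [InnerProductSpace ℂ H'] [CompleteSpace H']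
      (A' : H' →ₗ.[ℂ] H') (Θ' : ScalarLSystem A'),
      Θ.IsUnimodularTransformation α Θ' → Θ'.impedance ∈ C) ∧
    (∀ (H' : Type v) [NormedAddCommGroup H'] [InnerProductSpace ℂ H'] [CompleteSpace H']
      (A' : H' →ₗ.[ℂ] H') (Θ' : ScalarLSystem A') (α' : ℝ),
      Θ.IsUnimodularTransformation α' Θ' → Θ'.impedance ∈ C → α' = α) ∧
    (∀ Θ₁ Θ₂ : ScalarLSystem A, Θ₁.T = Θ.T → Θ₂.T = Θ.T →
      Θ.IsUnimodularTransformation α Θ₁ → Θ.IsUnimodularTransformation α Θ₂ →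
      Θ₁.S = Θ₂.S ∧ ∃ c : ℂ, ‖c‖ = 1 ∧ Θ₁.K = c • Θ₂.K)

end LSys

end

/-! Let k = K* as a functional on H₊. Since Im 𝔸 = KK*, k splits as k = u + w, where ker u = dom T,
ker w = dom T* and (A*f, g) − (f, A*g) = 2i (w(f) conj w(g) − u(f) conj u(g)). In these terms 𝔸 = A*
+ 2i u(·) conj k and Re 𝔸 = A* + i (u − w)(·) conj k (`ScalarLSystem.exists_isBoundaryPair`).
Solving the two resolvent equations on a vector n of Ker(A* − z) gives W(z) = −w(n)/u(n) and V(z) =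
i(1 + τ)/(1 − τ) with τ(z) = u(n)/w(n). The Green identity between z and its conjugate turns this
into W(conj z) = −conj τ(z) for Im z > 0 (`ScalarLSystem.exists_cayley`). A unimodular
transformation therefore rotates τ by a constant, whatever space the new system lives in.

On the function side, V(i) = Q + ia for V in a Donoghue class, and 4y Im V(iy) / |V(iy) + i|² = y(1
− |τ(iy)|²). This quantity is unchanged by rotating τ. It is unbounded when the measure is infinite
and there is no linear term, and bounded for y ≥ 1 when a linear term is present or the measure is
finite. Hence the rotated function is again in a Donoghue class, and its value at i decides which
one (`mem_donoghue_of_cayley`). The Nevanlinna representation used here is derived from the Schwarz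
formula and weak compactness on the circle.

The values of τ(i) belonging to Q + ia and −Q + ia are complex conjugates, hence of equal modulus,
and they are non-zero because Q ≠ 0. Exactly one rotation takes one to the other, which fixes α.
Existence with the same T comes from replacing w by ωw, |ω| = 1 (`IsBoundaryPair.rotate`).
Uniqueness of 𝔸 and K holds because boundary pairs of the same T differ by unimodular factors, and W
fixes the ratio of these factors (`ScalarLSystem.eq_of_transfer_eq`). -/

namespace LSys

/-! ### Lower bounds and resolvents of unbounded operators -/

variable {H : Type u} [NormedAddCommGroup H] [InnerProductSpace ℂ H]

theorem mem_resolventSet_of_surjective {B : H →ₗ.[ℂ] H} {z : ℂ} {c : ℝ} (hc : 0 < c)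
    (hbound : ∀ x : B.domain, c * ‖(x : H)‖ ≤ ‖B x - z • (x : H)‖)
    (hsurj : ∀ h : H, ∃ x : B.domain, B x - z • (x : H) = h) : z ∈ resolventSet B := by
  let L : B.domain →ₗ[ℂ] H := B.toFun - z • B.domain.subtype
  have hL : ∀ x, L x = B x - z • (x : H) := fun x => rfl
  have hinj : Function.Injective L := by
    rw [injective_iff_map_eq_zero]
    intro x hx
    have h := hbound x
    rw [← hL, hx, norm_zero] at h
    have : ‖(x : H)‖ ≤ 0 := by
      by_contra hn
      push Not at hn
      nlinarith
    simpa using this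
  let e := LinearEquiv.ofBijective L ⟨hinj, fun h => hsurj h⟩
  have he : ∀ x, e x = B x - z • (x : H) := fun x => rfl
  refine ⟨(B.domain.subtype.comp e.symm.toLinearMap).mkContinuous c⁻¹ fun h => ?_, fun h => ?_,
    fun x => ?_⟩
  · have h1 := hbound (e.symm h)
    rw [← he, e.apply_symm_apply] at h1
    rw [inv_mul_eq_div, le_div_iff₀ hc, mul_comm]
    exact h1
  · exact ⟨e.symm h, rfl, by rw [← he, e.apply_symm_apply]⟩
  · have h1 : e.symm (B x - z • (x : H)) = x := by rw [← he, e.symm_apply_apply]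
    simp [h1]

/-- The imaginary part of `inner ℂ x (y - z • x)` is a sum of two terms that, by the hypothesis, do
not have opposite signs; one of them is −Im z ‖x‖². Cauchy–Schwarz finishes. This serves
self-adjoint operators for all z, and dissipative ones in the lower half-plane. -/
theorem abs_im_mul_norm_le {x y : H} {z : ℂ} (h : 0 ≤ -z.im * (inner ℂ x y).im) :
    |z.im| * ‖x‖ ≤ ‖y - z • x‖ := by
  rcases eq_or_ne x 0 with rfl | hx
  · simp
  have hx' : 0 < ‖x‖ := norm_pos_iff.2 hx
  have h1 : (inner ℂ x (y - z • x)).im = (inner ℂ x y).im - z.im * ‖x‖ ^ 2 := by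
    rw [inner_sub_right, inner_smul_right, inner_self_eq_norm_sq_to_K]
    simp [← Complex.ofReal_pow]
  have h2 : |(inner ℂ x (y - z • x)).im| ≤ ‖x‖ * ‖y - z • x‖ :=
    (Complex.abs_im_le_norm _).trans (norm_inner_le_norm _ _)
  have h3 : |z.im| * ‖x‖ ^ 2 ≤ |(inner ℂ x (y - z • x)).im| := by
    rw [h1]
    have hp : 0 < ‖x‖ ^ 2 := by positivity
    rcases le_total 0 z.im with h0 | h0
    · rcases h0.eq_or_lt with h00 | h00
      · rw [← h00]; simp
      · have : (inner ℂ x y).im ≤ 0 := by nlinarith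
        rw [abs_of_nonneg h0, abs_of_nonpos (by nlinarith)]
        linarith
    · rcases h0.eq_or_lt with h00 | h00
      · rw [h00]; simp
      · have : 0 ≤ (inner ℂ x y).im := by nlinarith
        rw [abs_of_nonpos h0, abs_of_nonneg (by nlinarith)]
        linarith
  have : ‖x‖ * (|z.im| * ‖x‖) ≤ ‖x‖ * ‖y - z • x‖ := by nlinarith
  exact le_of_mul_le_mul_left this hx'

variable [CompleteSpace H]

theorem im_inner_eq_zero_of_isSelfAdjoint {B : H →ₗ.[ℂ] H} (hB : IsSelfAdjoint B)
    (x : B.domain) : (inner ℂ (x : H) (B x)).im = 0 := by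
  have h1 : B.IsFormalAdjoint B := by
    have := LinearPMap.adjoint_isFormalAdjoint (T := B) hB.dense_domain
    rwa [LinearPMap.isSelfAdjoint_def.1 hB] at this
  have h2 := h1 x x
  have h3 := inner_conj_symm (𝕜 := ℂ) (x : H) (B x)
  rw [h2] at h3
  exact Complex.conj_eq_iff_im.1 h3

/-- The lower bound and closedness of `B` make the range of B − z closed. A vector orthogonal to it
is an eigenvector of B* = B for conj z, which the same bound excludes. -/
theorem exists_sub_smul_eq_of_isSelfAdjoint {B : H →ₗ.[ℂ] H} (hB : IsSelfAdjoint B) {z : ℂ}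
    (hz : z.im ≠ 0) (h : H) : ∃ x : B.domain, B x - z • (x : H) = h := by
  have hbound : ∀ x : B.domain, |z.im| * ‖(x : H)‖ ≤ ‖B x - z • (x : H)‖ := fun x =>
    abs_im_mul_norm_le (by rw [im_inner_eq_zero_of_isSelfAdjoint hB]; simp)
  have hz' : 0 < |z.im| := abs_pos.2 hz
  let L : B.domain →ₗ[ℂ] H := B.toFun - z • B.domain.subtype
  have hL : ∀ x, L x = B x - z • (x : H) := fun x => rfl
  have hclosed : IsClosed (L.range : Set H) := by
    rw [← isSeqClosed_iff_isClosed]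
    intro y y₀ hy hlim
    choose x hx using hy
    have hcau : CauchySeq fun n => (x n : H) := by
      rw [Metric.cauchySeq_iff']
      intro ε hε
      obtain ⟨N, hN⟩ := Metric.cauchySeq_iff'.1 hlim.cauchySeq (|z.im| * ε) (by positivity)
      refine ⟨N, fun n hn => ?_⟩
      have h1 := hN n hn
      rw [dist_eq_norm, ← hx n, ← hx N, ← map_sub] at h1
      have h2 := (hbound (x n - x N)).trans_lt h1
      rw [dist_eq_norm]
      exact lt_of_mul_lt_mul_left h2 hz'.le
    obtain ⟨x₀, hx₀⟩ := cauchySeq_tendsto_of_complete hcau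
    have h3 : Filter.Tendsto (fun n => ((x n : H), B (x n))) Filter.atTop
        (nhds (x₀, y₀ + z • x₀)) := by
      refine hx₀.prodMk_nhds ?_
      have : ∀ n, B (x n) = y n + z • (x n : H) := fun n => by
        rw [← hx n, hL]; abel
      simp_rw [this]
      exact hlim.add (hx₀.const_smul z)
    have h4 : (x₀, y₀ + z • x₀) ∈ B.graph :=
      hB.isClosed.mem_of_tendsto h3 (Filter.Eventually.of_forall fun n => B.mem_graph (x n))
    obtain ⟨x', hx1, hx2⟩ := (LinearPMap.mem_graph_iff _).1 h4
    refine ⟨x', ?_⟩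
    rw [hL, hx2]
    simp only at hx1
    rw [hx1]
    simp
  have htop : L.range = ⊤ := by
    have : CompleteSpace L.range := hclosed.completeSpace_coe
    rw [← Submodule.orthogonal_eq_bot_iff, Submodule.eq_bot_iff]
    intro v hv
    have hv' : ∀ x : B.domain, inner ℂ (conj z • v) (x : H) = inner ℂ v (B x) := by
      intro x
      have := (Submodule.mem_orthogonal' _ _).1 hv _ ⟨x, rfl⟩
      rw [hL, inner_sub_right, inner_smul_right, sub_eq_zero] at this
      rw [inner_smul_left, this]; simp
    have hvd : v ∈ B†.domain := LinearPMap.mem_adjoint_domain_of_exists v ⟨_, hv'⟩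
    have hve : B† ⟨v, hvd⟩ = conj z • v := LinearPMap.adjoint_apply_eq hB.dense_domain _ hv'
    have hmem : (v, conj z • v) ∈ B.graph := by
      have := B†.mem_graph ⟨v, hvd⟩
      rw [hve] at this
      change (v, conj z • v) ∈ B†.graph at this
      rwa [LinearPMap.isSelfAdjoint_def.1 hB] at this
    obtain ⟨x', hx1, hx2⟩ := (LinearPMap.mem_graph_iff _).1 hmem
    have h5 := abs_im_mul_norm_le (x := (x' : H)) (y := B x') (z := conj z)
      (by rw [im_inner_eq_zero_of_isSelfAdjoint hB]; simp)
    rw [hx2] at h5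
    simp only at hx1
    rw [hx1] at h5
    simp only [Complex.conj_im, abs_neg, sub_self, norm_zero] at h5
    have : ‖v‖ ≤ 0 := by
      by_contra hn
      push Not at hn
      nlinarith
    simpa using this
  have : h ∈ L.range := by rw [htop]; trivial
  exact this

end LSys

/-! ### The rigged space and quasi-kernels -/

namespace LSys

variable {H : Type u} [NormedAddCommGroup H] [InnerProductSpace ℂ H] [CompleteSpace H]
  {A T : H →ₗ.[ℂ] H}

open Complex (I)

theorem emb_apply (A : H →ₗ.[ℂ] H) (h : H) (f : HPlus A) :
    emb A h f = inner ℂ (HPlus.incl A f) h := rfl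

theorem HPlus.exists_incl_eq (hA : Dense (A.domain : Set H)) {x y : H}
    (h : ∀ a : A.domain, inner ℂ y (a : H) = inner ℂ x (A a)) :
    ∃ f : HPlus A, HPlus.incl A f = x ∧ HPlus.star A f = y := by
  have hd : x ∈ A†.domain := LinearPMap.mem_adjoint_domain_of_exists x ⟨_, h⟩
  have he : A† ⟨x, hd⟩ = y := LinearPMap.adjoint_apply_eq hA _ h
  have hm : (x, y) ∈ A†.graph := by
    have := A†.mem_graph ⟨x, hd⟩
    rw [he] at this
    exact this
  exact ⟨⟨WithLp.toLp 2 (x, y), hm⟩, rfl, rfl⟩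

theorem HPlus.exists_of_le (hT : T ≤ A†) (x : T.domain) :
    ∃ f : HPlus A, HPlus.incl A f = x ∧ HPlus.star A f = T x :=
  ⟨⟨WithLp.toLp 2 ((x : H), T x), LinearPMap.le_graph_of_le hT (T.mem_graph x)⟩, rfl, rfl⟩

theorem HPlus.star_eq_of_le (hT : T ≤ A†) (f : HPlus A) (x : T.domain)
    (h : HPlus.incl A f = x) : HPlus.star A f = T x := by
  obtain ⟨g, hg1, hg2⟩ := HPlus.exists_of_le hT x
  rw [HPlus.incl_injective A (h.trans hg1.symm), hg2]

theorem HPlus.inner_incl_apply (hA : Dense (A.domain : Set H)) (f : HPlus A) (a : A.domain) :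
    inner ℂ (HPlus.incl A f) (A a) = inner ℂ (HPlus.star A f) (a : H) := by
  obtain ⟨x, hx1, hx2⟩ := (LinearPMap.mem_graph_iff _).1 (HPlus.mem_graph A f)
  simp only at hx1 hx2
  rw [← hx1, ← hx2]
  exact (LinearPMap.adjoint_isFormalAdjoint hA x a).symm

/-- A closed densely defined operator contains its double adjoint. -/
theorem mem_graph_of_forall_HPlus (hA : Dense (A.domain : Set H)) (hc : A.IsClosed) {x y : H}
    (h : ∀ g : HPlus A, inner ℂ (HPlus.incl A g) y = inner ℂ (HPlus.star A g) x) :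
    (x, y) ∈ A.graph := by
  let M : Submodule ℂ (WithLp 2 (H × H)) :=
    A.graph.comap (WithLp.linearEquiv 2 ℂ (H × H)).toLinearMap
  have hM : IsClosed (M : Set (WithLp 2 (H × H))) :=
    IsClosed.preimage (WithLp.prod_continuous_ofLp 2 H H) hc
  have : CompleteSpace M := hM.completeSpace_coe
  suffices WithLp.toLp 2 (x, y) ∈ M from this
  rw [← Submodule.orthogonal_orthogonal M, Submodule.mem_orthogonal]
  intro p hp
  -- Orthogonality of (p₁, p₂) to the graph of A says that p₂ ∈ dom A* and A*p₂ = −p₁.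
  have hp' : ∀ a : A.domain, inner ℂ (-p.fst) (a : H) = inner ℂ p.snd (A a) := by
    intro a
    have h1 := (Submodule.mem_orthogonal' _ _).1 hp (WithLp.toLp 2 ((a : H), A a))
      (A.mem_graph a)
    rw [WithLp.prod_inner_apply] at h1
    rw [inner_neg_left]
    exact neg_eq_of_add_eq_zero_right h1
  obtain ⟨g, hg1, hg2⟩ := HPlus.exists_incl_eq hA hp'
  have h2 := h g
  rw [hg1, hg2, inner_neg_left] at h2
  rw [WithLp.prod_inner_apply]
  change inner ℂ p.fst x + inner ℂ p.snd y = 0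
  rw [h2]; simp

/-- `(u, w)` is a pair of boundary functionals for `A ⊂ T ⊂ A*`: they diagonalize the boundary
form, and their kernels are the domains of `T` and of `T*`. -/
structure IsBoundaryPair (A T : H →ₗ.[ℂ] H) (u w : HPlus A →L[ℂ] ℂ) : Prop where
  green : ∀ f g : HPlus A, inner ℂ (HPlus.incl A g) (HPlus.star A f) -
    inner ℂ (HPlus.star A g) (HPlus.incl A f) = 2 * I * (w f * conj (w g) - u f * conj (u g))
  mem_domain_iff : ∀ f : HPlus A, HPlus.incl A f ∈ T.domain ↔ u f = 0
  mem_adjoint_domain_iff : ∀ f : HPlus A, HPlus.incl A f ∈ T†.domain ↔ w f = 0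
  exists_left : ∃ f, u f = 0 ∧ w f = 1
  exists_right : ∃ f, w f = 0 ∧ u f = 1

/-- `S` acts as `S f = A* f + 2i u(f) conj(k)`. -/
def HasStateForm (S : HPlus A →L[ℂ] HMinus A) (u k : HPlus A →L[ℂ] ℂ) : Prop :=
  ∀ f g : HPlus A, S f g = inner ℂ (HPlus.incl A g) (HPlus.star A f) + 2 * I * u f * conj (k g)

theorem rePart_apply (S : HPlus A →L[ℂ] HMinus A) (f g : HPlus A) :
    rePart S f g = (S f g + conj (S g f)) / 2 := by
  simp [rePart, adj_apply]; ring

theorem imPart_apply (S : HPlus A →L[ℂ] HMinus A) (f g : HPlus A) :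
    imPart S f g = (S f g - conj (S g f)) / (2 * I) := by
  simp only [imPart, smul_apply, sub_apply, adj_apply,
    smul_eq_mul]
  ring

theorem apply_eq_of_chanAdj (K : ℂ →L[ℂ] HMinus A) (e : ℂ) (g : HPlus A) :
    K e g = e * conj (chanAdj K g) := by
  rw [← inner_chanAdj]; simp

/-- A functional that vanishes on `dom A` is not in `H`. -/
theorem eq_zero_of_emb_add_eq_zero (hA : Dense (A.domain : Set H)) {k : HPlus A →L[ℂ] ℂ}
    (hk : ∀ f : HPlus A, HPlus.incl A f ∈ A.domain → k f = 0) (hk0 : ∃ f, k f ≠ 0)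
    (hsymm : A ≤ A†) {h : H} {c : ℂ}
    (hc : ∀ g : HPlus A, inner ℂ (HPlus.incl A g) h + c * conj (k g) = 0) : h = 0 ∧ c = 0 := by
  have h2 : h = 0 := by
    refine hA.eq_zero_of_inner_right ℂ fun a ha => ?_
    obtain ⟨g, hg, -⟩ := HPlus.exists_of_le hsymm ⟨a, ha⟩
    have := hc g
    rw [hg, hk g (by rw [hg]; exact ha)] at this
    rwa [map_zero, mul_zero, add_zero] at this
  obtain ⟨g, hg⟩ := hk0
  have := hc g
  rw [h2] at this
  exact ⟨h2, by simpa [hg] using this⟩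

/-- The quasi-kernel of an operator of the form `A* + c(·) conj(k)`, `c ∈ (H₊)'`. -/
theorem mem_quasiKernel_graph_iff (hA : Dense (A.domain : Set H))
    {R : HPlus A →L[ℂ] HMinus A} {c k : HPlus A →L[ℂ] ℂ}
    (hR : ∀ f g : HPlus A,
      R f g = inner ℂ (HPlus.incl A g) (HPlus.star A f) + c f * conj (k g))
    (hk : ∀ f : HPlus A, HPlus.incl A f ∈ A.domain → k f = 0) (hk0 : ∃ f, k f ≠ 0)
    (hsymm : A ≤ A†) (p : H × H) :
    p ∈ (quasiKernel R).graph ↔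
      ∃ f : HPlus A, c f = 0 ∧ HPlus.incl A f = p.1 ∧ HPlus.star A f = p.2 := by
  -- conj k does not lie in H, so R f lies in H only if its coefficient c(f) vanishes; then R f =
  -- A*f.
  have key : ∀ (f : HPlus A) (h : H), R f = emb A h ↔ c f = 0 ∧ HPlus.star A f = h := by
    intro f h
    constructor
    · intro hf
      have h1 : ∀ g, inner ℂ (HPlus.incl A g) (HPlus.star A f - h) + c f * conj (k g) = 0 := by
        intro g
        have := congrArg (fun φ : HMinus A => φ g) hf
        simp only [hR, emb_apply] at this
        rw [inner_sub_right, ← this]; ring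
      obtain ⟨h2, h3⟩ := eq_zero_of_emb_add_eq_zero hA hk hk0 hsymm h1
      exact ⟨h3, sub_eq_zero.1 h2⟩
    · rintro ⟨h1, rfl⟩
      ext g
      rw [hR, h1, emb_apply]; simp
  have hgr : ∀ p : H × H, p ∈ ((LinearMap.eqLocus
      (R.toLinearMap.comp (LinearMap.fst ℂ (HPlus A) H))
      ((emb A).comp (LinearMap.snd ℂ (HPlus A) H))).map
        ((HPlus.incl A).toLinearMap.prodMap LinearMap.id) : Submodule ℂ (H × H)) ↔
      ∃ f : HPlus A, c f = 0 ∧ HPlus.incl A f = p.1 ∧ HPlus.star A f = p.2 := by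
    intro p
    rw [Submodule.mem_map]
    constructor
    · rintro ⟨⟨f, h⟩, hfh, rfl⟩
      obtain ⟨h1, h2⟩ := (key f h).1 hfh
      exact ⟨f, h1, rfl, h2⟩
    · rintro ⟨f, h1, h2, h3⟩
      exact ⟨(f, p.2), (key f p.2).2 ⟨h1, h3⟩, Prod.ext h2 rfl⟩
  rw [quasiKernel, Submodule.toLinearPMap_graph_eq, hgr]
  intro q hq hq1
  obtain ⟨f, -, h1, h2⟩ := (hgr q).1 hq
  rw [← h2, HPlus.star_eq A f 0 (by rw [h1, hq1]; rfl)]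
  simp

end LSys

/-! ### The boundary pair of an L-system -/

namespace LSys

variable {H : Type u} [NormedAddCommGroup H] [InnerProductSpace ℂ H] [CompleteSpace H]
  {A T : H →ₗ.[ℂ] H}

open Complex (I)

theorem IsQuasiSelfAdjointExt.le_adjoint_self (h : IsQuasiSelfAdjointExt A T) : A ≤ A† :=
  h.le.trans h.le_adjoint

theorem adjoint_le_adjoint (hA : Dense (A.domain : Set H)) (h : A ≤ T) : T† ≤ A† := by
  refine LinearPMap.IsFormalAdjoint.le_adjoint hA fun x y => ?_
  have h1 := (LinearPMap.adjoint_isFormalAdjoint (hA.mono h.1)).symm ⟨x, h.1 x.2⟩ y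
  rw [← h1, show A x = T ⟨x, h.1 x.2⟩ from h.2 rfl]

theorem rePart_apply_of_hasStateForm {u w : HPlus A →L[ℂ] ℂ}
    (green : ∀ f g : HPlus A, inner ℂ (HPlus.incl A g) (HPlus.star A f) -
      inner ℂ (HPlus.star A g) (HPlus.incl A f) = 2 * I * (w f * conj (w g) - u f * conj (u g)))
    {S : HPlus A →L[ℂ] HMinus A} (hS : HasStateForm S u (u + w)) (f g : HPlus A) :
    rePart S f g = inner ℂ (HPlus.incl A g) (HPlus.star A f) +
      (I • (u - w)) f * conj ((u + w) g) := by
  have h := green f g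
  rw [rePart_apply, hS, hS]
  simp only [map_add, map_mul, inner_conj_symm, Complex.conj_I, Complex.conj_conj,
    add_apply, smul_apply, sub_apply,
    smul_eq_mul, Complex.conj_ofNat]
  linear_combination (-1 / 2 : ℂ) * h

namespace ScalarLSystem

theorem sub_conj_eq (Θ : ScalarLSystem A) (f g : HPlus A) :
    Θ.S f g - conj (Θ.S g f) = 2 * I * chanAdj Θ.K f * conj (chanAdj Θ.K g) := by
  have h1 := imPart_apply Θ.S f g
  rw [Θ.imPart_eq, ContinuousLinearMap.comp_apply, apply_eq_of_chanAdj,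
    eq_div_iff (by simp)] at h1
  rw [← h1]; ring

/-- dom T contains a vector f₀ with k(f₀) = 1, since T is not symmetric. Normalized pairing with f₀
in the Green form defines w, and u is k − w. The inclusions 𝔸 ⊃ T and 𝔸* ⊃ T* identify the kernels
and the form of 𝔸; self-adjointness of the quasi-kernel is needed only to see that u does not
vanish. -/
theorem exists_isBoundaryPair (Θ : ScalarLSystem A) : ∃ u w : HPlus A →L[ℂ] ℂ,
    IsBoundaryPair A Θ.T u w ∧ HasStateForm Θ.S u (u + w) ∧ chanAdj Θ.K = u + w := by
  have hA : Dense (A.domain : Set H) := Θ.isSymmOp.dense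
  have hq := Θ.memLambda.quasi
  have hT : Dense (Θ.T.domain : Set H) := hA.mono hq.le.1
  have hsymm : A ≤ A† := hq.le.trans hq.le_adjoint
  set k := chanAdj Θ.K with hk
  have hsub : ∀ f g : HPlus A, Θ.S f g - conj (Θ.S g f) = 2 * I * k f * conj (k g) :=
    Θ.sub_conj_eq
  have hTadj : Θ.T† ≤ A† := adjoint_le_adjoint hA hq.le
  -- the values of `S` on `dom T`, and of `S*` on `dom T*`
  have hST : ∀ f g : HPlus A, HPlus.incl A f ∈ Θ.T.domain →
      Θ.S f g = inner ℂ (HPlus.incl A g) (HPlus.star A f) := by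
    intro f g hf
    obtain ⟨f', h1, h2⟩ := Θ.isStarExt.biExt.ext ⟨_, hf⟩
    rw [HPlus.incl_injective A h1] at h2
    rw [h2, emb_apply, HPlus.star_eq_of_le hq.le_adjoint f ⟨_, hf⟩ rfl]
  have hST' : ∀ f g : HPlus A, HPlus.incl A f ∈ Θ.T†.domain →
      conj (Θ.S g f) = inner ℂ (HPlus.incl A g) (HPlus.star A f) := by
    intro f g hf
    obtain ⟨f', h1, h2⟩ := Θ.isStarExt.biExt.ext_adj ⟨_, hf⟩
    rw [HPlus.incl_injective A h1] at h2
    rw [← adj_apply, h2, emb_apply, HPlus.star_eq_of_le hTadj f ⟨_, hf⟩ rfl]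
  have hmemadj : ∀ f : HPlus A, (∀ g : HPlus A, HPlus.incl A g ∈ Θ.T.domain →
      inner ℂ (HPlus.incl A f) (HPlus.star A g) = inner ℂ (HPlus.star A f) (HPlus.incl A g)) →
      HPlus.incl A f ∈ Θ.T†.domain := by
    intro f hf
    refine LinearPMap.mem_adjoint_domain_of_exists _ ⟨HPlus.star A f, fun x => ?_⟩
    obtain ⟨g, hg1, hg2⟩ := HPlus.exists_of_le hq.le_adjoint x
    rw [← hg1, ← hg2, hf g (by rw [hg1]; exact x.2)]
  -- On dom T, 𝔸 acts as A*, so k(f) = 0 makes the Green form of f with dom T vanish.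
  have hker : ∀ f : HPlus A, HPlus.incl A f ∈ Θ.T.domain → k f = 0 →
      HPlus.incl A f ∈ Θ.T†.domain := by
    intro f hf hkf
    refine hmemadj f fun g hg => ?_
    have h1 := hsub f g
    rw [hkf, hST f g hf, hST g f hg] at h1
    rw [inner_conj_symm] at h1
    have h2 : inner ℂ (HPlus.incl A g) (HPlus.star A f) =
        inner ℂ (HPlus.star A g) (HPlus.incl A f) := by
      linear_combination h1
    rw [← inner_conj_symm (HPlus.star A f), h2, inner_conj_symm]
  -- If k vanished on dom T, then T ⊂ T*, against the non-symmetry of T.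
  have hexists : ∃ f₀ : HPlus A, HPlus.incl A f₀ ∈ Θ.T.domain ∧ k f₀ = 1 := by
    by_contra hno
    have h0 : ∀ f : HPlus A, HPlus.incl A f ∈ Θ.T.domain → k f = 0 := by
      intro f hf
      by_contra hkf
      refine hno ⟨(k f)⁻¹ • f, ?_, by simp [hkf]⟩
      rw [map_smul]; exact Θ.T.domain.smul_mem _ hf
    refine hq.not_symm fun x y => ?_
    obtain ⟨f, hf1, hf2⟩ := HPlus.exists_of_le hq.le_adjoint x
    have hf : HPlus.incl A f ∈ Θ.T.domain := by rw [hf1]; exact x.2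
    have h1 := LinearPMap.adjoint_isFormalAdjoint hT ⟨_, hker f hf (h0 f hf)⟩ y
    rw [← HPlus.star_eq_of_le hTadj f ⟨_, hker f hf (h0 f hf)⟩ rfl, hf2] at h1
    rw [h1, ← hf1]
  obtain ⟨f₀, hf₀, hkf₀⟩ := hexists
  have hf₀f₀ : inner ℂ (HPlus.incl A f₀) (HPlus.star A f₀) -
      inner ℂ (HPlus.star A f₀) (HPlus.incl A f₀) = 2 * I := by
    have h1 := hsub f₀ f₀
    rw [hST f₀ f₀ hf₀, hkf₀, inner_conj_symm] at h1
    simpa using h1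
  let w : HPlus A →L[ℂ] ℂ := (2 * I)⁻¹ • ((innerSL ℂ (HPlus.incl A f₀)).comp (HPlus.star A) -
    (innerSL ℂ (HPlus.star A f₀)).comp (HPlus.incl A))
  have hw : ∀ f, 2 * I * w f = inner ℂ (HPlus.incl A f₀) (HPlus.star A f) -
      inner ℂ (HPlus.star A f₀) (HPlus.incl A f) := by
    intro f
    simp only [w, smul_apply, sub_apply,
      ContinuousLinearMap.comp_apply, innerSL_apply_apply, smul_eq_mul]
    rw [mul_inv_cancel_left₀ (by simp)]
  have hwf₀ : w f₀ = 1 := by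
    have := hw f₀
    rw [hf₀f₀] at this
    exact mul_left_cancel₀ (a := 2 * I) (by simp) (by rw [this, mul_one])
  -- `w` vanishes exactly on `dom T*`
  have hdomA : ∀ f : HPlus A, HPlus.incl A f ∈ A.domain ↔
      HPlus.incl A f ∈ Θ.T.domain ∧ HPlus.incl A f ∈ Θ.T†.domain := by
    intro f; rw [Θ.memLambda.domain_eq]; rfl
  have hwT : ∀ f : HPlus A, HPlus.incl A f ∈ Θ.T†.domain ↔ w f = 0 := by
    intro f
    constructor
    · intro hf
      have h1 := LinearPMap.adjoint_isFormalAdjoint hT ⟨_, hf⟩ ⟨_, hf₀⟩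
      rw [← HPlus.star_eq_of_le hTadj f ⟨_, hf⟩ rfl,
        ← HPlus.star_eq_of_le hq.le_adjoint f₀ ⟨_, hf₀⟩ rfl] at h1
      have h2 := hw f
      rw [← inner_conj_symm (HPlus.incl A f₀), ← inner_conj_symm (HPlus.star A f₀)] at h2
      simp only at h1
      rw [h1, sub_self] at h2
      simpa using h2
    · intro hf
      refine hmemadj f fun g hg => ?_
      have hgA : HPlus.incl A (g - k g • f₀) ∈ A.domain := by
        have h1 : HPlus.incl A (g - k g • f₀) ∈ Θ.T.domain := by
          rw [map_sub, map_smul]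
          exact Θ.T.domain.sub_mem hg (Θ.T.domain.smul_mem _ hf₀)
        exact (hdomA _).2 ⟨h1, hker _ h1 (by simp [hkf₀])⟩
      have h3 := HPlus.inner_incl_apply hA f ⟨_, hgA⟩
      rw [← HPlus.star_eq_of_le hsymm _ ⟨_, hgA⟩ rfl] at h3
      simp only [map_sub, map_smul, inner_sub_right, inner_smul_right] at h3
      have h4 := hw f
      rw [hf, mul_zero] at h4
      have h5 := congrArg (starRingEnd ℂ) h4
      rw [map_zero, map_sub, inner_conj_symm, inner_conj_symm] at h5
      linear_combination h3 + k g * h5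
  let u : HPlus A →L[ℂ] ℂ := k - w
  have hu : ∀ f, u f = k f - w f := fun f => rfl
  have huw : u + w = k := sub_add_cancel k w
  have huf₀ : u f₀ = 0 := by rw [hu, hkf₀, hwf₀, sub_self]
  have hS : HasStateForm Θ.S u (u + w) := by
    intro f g
    -- Split f into a part in dom T*, where 𝔸* acts as A* and 𝔸 differs from 𝔸* by 2i k(·) conj k,
    -- and a multiple of f₀, where 𝔸 acts as A*.
    have h1 : w (f - w f • f₀) = 0 := by simp [hwf₀]
    have h2 := hST' _ g ((hwT _).2 h1)
    have h3 := hST f₀ g hf₀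
    have h4 := hsub (f - w f • f₀) g
    rw [h2] at h4
    simp only [map_sub, map_smul, sub_apply, smul_apply,
      smul_eq_mul, inner_sub_right, inner_smul_right, h3, hkf₀, mul_one] at h4
    rw [huw, hu]
    linear_combination h4
  have green : ∀ f g : HPlus A, inner ℂ (HPlus.incl A g) (HPlus.star A f) -
      inner ℂ (HPlus.star A g) (HPlus.incl A f) =
        2 * I * (w f * conj (w g) - u f * conj (u g)) := by
    intro f g
    have h1 := hsub f g
    rw [hS, hS, huw] at h1
    simp only [map_add, map_mul, inner_conj_symm, Complex.conj_I, Complex.conj_conj,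
      Complex.conj_ofNat] at h1
    have hku : k f = u f + w f := by rw [hu]; ring
    have hkg : k g = u g + w g := by rw [hu]; ring
    rw [hku, hkg, map_add] at h1
    linear_combination h1
  have hkA : ∀ f : HPlus A, HPlus.incl A f ∈ A.domain → k f = 0 := by
    intro f hf
    obtain ⟨h1, h2⟩ := (hdomA f).1 hf
    have h3 := hsub f f₀
    rw [hST f f₀ h1, hST' f f₀ h2, sub_self, hkf₀] at h3
    simpa using h3.symm
  have huT : ∀ f : HPlus A, HPlus.incl A f ∈ Θ.T.domain ↔ u f = 0 := by
    intro f
    constructor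
    · intro hf
      have h1 : HPlus.incl A (f - k f • f₀) ∈ Θ.T.domain := by
        rw [map_sub, map_smul]
        exact Θ.T.domain.sub_mem hf (Θ.T.domain.smul_mem _ hf₀)
      have h2 : k (f - k f • f₀) = 0 := by simp [hkf₀]
      have h3 := (hwT _).1 (hker _ h1 h2)
      simp only [map_sub, map_smul, hwf₀, smul_eq_mul, mul_one] at h3
      rw [hu]; linear_combination -h3
    · intro hf
      -- Both u and w vanish on this vector, so its Green form with all of H₊ is zero; as A** = A,
      -- it lies in dom A.
      have h1 : (HPlus.incl A (f - w f • f₀), HPlus.star A (f - w f • f₀)) ∈ A.graph := by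
        refine mem_graph_of_forall_HPlus hA Θ.isSymmOp.closed fun g => ?_
        have := green (f - w f • f₀) g
        rw [sub_eq_iff_eq_add] at this
        rw [this]
        simp [hf, huf₀, hwf₀]
      have h2 := hq.le.1 (LinearPMap.mem_domain_of_mem_graph h1)
      have h3 : HPlus.incl A f = HPlus.incl A (f - w f • f₀) + w f • HPlus.incl A f₀ := by simp
      rw [h3]
      exact Θ.T.domain.add_mem h2 (Θ.T.domain.smul_mem _ hf₀)
  refine ⟨u, w, ⟨green, huT, hwT, ⟨f₀, huf₀, hwf₀⟩, ?_⟩, hS, huw.symm⟩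
  by_contra hno
  have hu0 : ∀ f, u f = 0 := by
    have h0 : ∀ f, w f = 0 → u f = 0 := by
      intro f hf
      by_contra hne
      exact hno ⟨(u f)⁻¹ • f, by simp [hf], by simp [hne]⟩
    intro f
    have := h0 (f - w f • f₀) (by simp [hwf₀])
    simpa [huf₀] using this
  have hgr := mem_quasiKernel_graph_iff hA (rePart_apply_of_hasStateForm green hS)
    (by rw [huw]; exact hkA) ⟨f₀, by rw [huw, hkf₀]; simp⟩ hsymm
  have hsa := Θ.isStarExt.re.quasiKernel_selfAdjoint
  -- If u = 0, the quasi-kernel is A* on ker w, and the Green identity puts f₀ in the domain of its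
  -- adjoint. Self-adjointness would then give w(f₀) = 0.
  have h1 : (HPlus.incl A f₀, HPlus.star A f₀) ∈ (quasiKernel (rePart Θ.S)).graph := by
    rw [← LinearPMap.isSelfAdjoint_def.1 hsa,
      LinearPMap.adjoint_graph_eq_graph_adjoint hsa.dense_domain, Submodule.mem_adjoint_iff]
    intro a b hab
    obtain ⟨f, hf1, hf2, hf3⟩ := (hgr _).1 hab
    have hwf : w f = 0 := by simpa [hu0] using hf1
    simp only at hf2 hf3
    rw [← hf2, ← hf3]
    have := congrArg (starRingEnd ℂ) (green f f₀)
    rw [map_sub, inner_conj_symm, inner_conj_symm, hwf, hu0] at this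
    simpa using this
  obtain ⟨f, hf1, hf2, -⟩ := (hgr _).1 h1
  rw [HPlus.incl_injective A hf2] at hf1
  simp [hu0, hwf₀] at hf1

end ScalarLSystem

end LSys

/-! ### Transfer and impedance functions on deficiency vectors -/

namespace LSys

variable {H : Type u} [NormedAddCommGroup H] [InnerProductSpace ℂ H] [CompleteSpace H]
  {A T : H →ₗ.[ℂ] H}

open Complex (I)

/-- For n in Ker(A* − z) with c(n) = 1, (R − z)n is exactly conj k. Since `applyInv` is defined by
`Function.invFun`, injectivity of R − z is also needed: (R − z)f = 0 separates into its H-component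
and its conj k-component. -/
theorem applyInv_eq (hA : Dense (A.domain : Set H)) {R : HPlus A →L[ℂ] HMinus A}
    {c k : HPlus A →L[ℂ] ℂ}
    (hR : ∀ f g : HPlus A,
      R f g = inner ℂ (HPlus.incl A g) (HPlus.star A f) + c f * conj (k g))
    (hk : ∀ f : HPlus A, HPlus.incl A f ∈ A.domain → k f = 0) (hk0 : ∃ f, k f ≠ 0)
    (hsymm : A ≤ A†) {z : ℂ}
    (hinj : ∀ f : HPlus A, HPlus.star A f = z • HPlus.incl A f → c f = 0 → f = 0)
    {n : HPlus A} (hn : HPlus.star A n = z • HPlus.incl A n) (hcn : c n = 1)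
    {φ : HMinus A} (hφ : ∀ g, φ g = conj (k g)) : applyInv R z φ = n := by
  have happ : ∀ f g : HPlus A, (R f - z • emb A (HPlus.incl A f)) g =
      inner ℂ (HPlus.incl A g) (HPlus.star A f - z • HPlus.incl A f) + c f * conj (k g) := by
    intro f g
    rw [sub_apply, smul_apply, hR, emb_apply, inner_sub_right, inner_smul_right, smul_eq_mul]
    ring
  have hfun : Function.Injective (fun f : HPlus A => R f - z • emb A (HPlus.incl A f)) := by
    intro f₁ f₂ h
    rw [← sub_eq_zero]
    have h1 : ∀ g : HPlus A, inner ℂ (HPlus.incl A g)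
        (HPlus.star A (f₁ - f₂) - z • HPlus.incl A (f₁ - f₂)) +
        c (f₁ - f₂) * conj (k g) = 0 := by
      intro g
      have h2 := congrArg (fun ψ : HMinus A => ψ g) h
      simp only [happ, inner_sub_right, inner_smul_right] at h2
      simp only [map_sub, inner_sub_right, inner_smul_right, smul_sub]
      linear_combination h2
    obtain ⟨h3, h4⟩ := eq_zero_of_emb_add_eq_zero hA hk hk0 hsymm h1
    exact hinj _ (sub_eq_zero.1 h3) h4
  have hval : (fun f : HPlus A => R f - z • emb A (HPlus.incl A f)) n = φ := by
    ext g
    simp only [happ]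
    rw [hn, hcn, hφ]; simp
  rw [applyInv, ← hval]
  exact Function.leftInverse_invFun hfun n

namespace IsBoundaryPair

variable {u w : HPlus A →L[ℂ] ℂ}

theorem im_mul_norm_sq (h : IsBoundaryPair A T u w) {z : ℂ} {n : HPlus A}
    (hn : HPlus.star A n = z • HPlus.incl A n) :
    z.im * ‖HPlus.incl A n‖ ^ 2 = ‖w n‖ ^ 2 - ‖u n‖ ^ 2 := by
  have h1 := h.green n n
  rw [hn, inner_smul_left, inner_smul_right, inner_self_eq_norm_sq_to_K, Complex.mul_conj',
    Complex.mul_conj', ← sub_mul, Complex.sub_conj] at h1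
  have h2 : ((z.im * ‖HPlus.incl A n‖ ^ 2 : ℝ) : ℂ) = ((‖w n‖ ^ 2 - ‖u n‖ ^ 2 : ℝ) : ℂ) := by
    refine mul_left_cancel₀ (a := 2 * I) (by simp) ?_
    push_cast at h1 ⊢
    linear_combination h1
  exact_mod_cast h2

theorem eq_zero_of_norm_eq (h : IsBoundaryPair A T u w) {z : ℂ} (hz : z.im ≠ 0) {n : HPlus A}
    (hn : HPlus.star A n = z • HPlus.incl A n) (huw : u n = w n) : n = 0 := by
  have h1 := h.im_mul_norm_sq hn
  rw [huw, sub_self] at h1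
  exact HPlus.incl_injective A (by simpa [hz] using h1)

/-- The left side of the Green identity cancels for the conjugate pair z, conj z. This is the bridge
between V in the upper half-plane and W in the lower one. -/
theorem conj_mul_eq (h : IsBoundaryPair A T u w) {z : ℂ} {n m : HPlus A}
    (hn : HPlus.star A n = z • HPlus.incl A n)
    (hm : HPlus.star A m = conj z • HPlus.incl A m) :
    w n * conj (w m) = u n * conj (u m) := by
  have h1 := h.green n m
  rw [hn, hm, inner_smul_left, inner_smul_right, Complex.conj_conj, sub_self] at h1
  have := mul_eq_zero.1 h1.symm
  simpa [sub_eq_zero] using this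

theorem add_eq_zero_of_mem (h : IsBoundaryPair A T u w) (hd : A.domain = T.domain ⊓ T†.domain)
    (f : HPlus A) (hf : HPlus.incl A f ∈ A.domain) : (u + w) f = 0 := by
  rw [hd] at hf
  rw [add_apply, (h.mem_domain_iff f).1 hf.1, (h.mem_adjoint_domain_iff f).1 hf.2, add_zero]

theorem exists_add_ne_zero (h : IsBoundaryPair A T u w) : ∃ f, (u + w) f ≠ 0 := by
  obtain ⟨f, hf1, hf2⟩ := h.exists_left
  exact ⟨f, by simp [hf1, hf2]⟩

end IsBoundaryPair

namespace ScalarLSystem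

variable {Θ : ScalarLSystem A} {u w : HPlus A →L[ℂ] ℂ}

theorem le_adjoint (Θ : ScalarLSystem A) : A ≤ A† := Θ.memLambda.quasi.le_adjoint_self

/-- Here c = i(u − w). Injectivity holds off the real axis, since u(f) = w(f) on Ker(A* − z) gives
Im z ‖f‖² = 0. -/
theorem impedance_eq (h : IsBoundaryPair A Θ.T u w) (hS : HasStateForm Θ.S u (u + w))
    (hK : chanAdj Θ.K = u + w) {z : ℂ} (hz : z.im ≠ 0) {n : HPlus A}
    (hn : HPlus.star A n = z • HPlus.incl A n) (hne : u n - w n ≠ 0) :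
    Θ.impedance z = -I * (u n + w n) / (u n - w n) := by
  have hI : I * (u n - w n) ≠ 0 := mul_ne_zero Complex.I_ne_zero hne
  have h1 : applyInv (rePart Θ.S) z (Θ.K 1) = (I * (u n - w n))⁻¹ • n := by
    refine applyInv_eq Θ.isSymmOp.dense (rePart_apply_of_hasStateForm h.green hS)
      (h.add_eq_zero_of_mem Θ.memLambda.domain_eq) h.exists_add_ne_zero Θ.le_adjoint
      (fun f hf hc => h.eq_zero_of_norm_eq hz hf ?_) ?_ ?_ fun g => ?_
    · simpa [sub_eq_zero] using hc
    · rw [map_smul, map_smul, hn, smul_comm]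
    · rw [map_smul]
      exact inv_mul_cancel₀ hI
    · rw [apply_eq_of_chanAdj, hK, one_mul]
  rw [impedance, h1, hK, map_smul, smul_eq_mul, add_apply, inv_mul_eq_div, div_eq_div_iff hI hne]
  linear_combination ((u n + w n) * (u n - w n)) * Complex.I_sq

/-- Here c = 2iu, and 1 − (u + w)/u = −w/u. Injectivity comes from z ∈ ρ(T): on Ker(A* − z), u(f) =
0 makes f an eigenvector of T unless f = 0. -/
theorem transfer_eq (h : IsBoundaryPair A Θ.T u w) (hS : HasStateForm Θ.S u (u + w))
    (hK : chanAdj Θ.K = u + w) {z : ℂ} (hz : z ∈ resolventSet Θ.T) {n : HPlus A}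
    (hn : HPlus.star A n = z • HPlus.incl A n) (hne : u n ≠ 0) :
    Θ.transfer z = -(w n / u n) := by
  have hI : 2 * I * u n ≠ 0 := by simp [hne]
  have h1 : applyInv Θ.S z (Θ.K 1) = (2 * I * u n)⁻¹ • n := by
    refine applyInv_eq Θ.isSymmOp.dense (c := (2 * I) • u) (fun f g => ?_)
      (h.add_eq_zero_of_mem Θ.memLambda.domain_eq) h.exists_add_ne_zero Θ.le_adjoint
      (fun f hf hc => ?_) ?_ ?_ fun g => ?_
    · rw [hS, smul_apply, smul_eq_mul]
    · have hf0 := (h.mem_domain_iff f).2 (by simpa using hc)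
      obtain ⟨R, -, hR⟩ := hz
      have h2 := hR ⟨_, hf0⟩
      rw [← HPlus.star_eq_of_le Θ.memLambda.quasi.le_adjoint f ⟨_, hf0⟩ rfl, hf, sub_self,
        map_zero] at h2
      exact HPlus.incl_injective A (by rw [map_zero]; exact h2.symm)
    · rw [map_smul, map_smul, hn, smul_comm]
    · rw [map_smul]
      exact inv_mul_cancel₀ hI
    · rw [apply_eq_of_chanAdj, hK, one_mul]
  rw [transfer, h1, hK, map_smul, smul_eq_mul, add_apply]
  field_simp
  ring

/-- The quasi-kernel of Re 𝔸 is A* restricted to ker(u − w), and it is self-adjoint. -/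
theorem exists_sub_smul_eq (h : IsBoundaryPair A Θ.T u w)
    (hS : HasStateForm Θ.S u (u + w)) {z : ℂ} (hz : z.im ≠ 0) (y : H) : ∃ g : HPlus A, HPlus.star A g - z • HPlus.incl A g = y ∧ u g = w g := by
  have hgr := mem_quasiKernel_graph_iff Θ.isSymmOp.dense (rePart_apply_of_hasStateForm h.green hS)
      (h.add_eq_zero_of_mem Θ.memLambda.domain_eq) h.exists_add_ne_zero Θ.le_adjoint
  obtain ⟨x, hx⟩ := exists_sub_smul_eq_of_isSelfAdjoint
    Θ.isStarExt.re.quasiKernel_selfAdjoint hz y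
  obtain ⟨g, hg1, hg2, hg3⟩ := (hgr _).1 (LinearPMap.mem_graph _ x)
  simp only at hg2 hg3
  refine ⟨g, by rw [hg2, hg3, hx], ?_⟩
  simpa [sub_eq_zero] using hg1

end ScalarLSystem

end LSys

/-! ### The two half-planes and the Cayley transform of the impedance function -/

namespace LSys

variable {H : Type u} [NormedAddCommGroup H] [InnerProductSpace ℂ H] [CompleteSpace H]
  {A T : H →ₗ.[ℂ] H}

open Complex (I)

namespace ScalarLSystem

variable {Θ : ScalarLSystem A} {u w : HPlus A →L[ℂ] ℂ}

/-- Take f with u(f) = 0, w(f) = 1 and subtract the vector of ker(u − w) that has the same image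
under A* − z; the value −1 of u − w survives. -/
theorem exists_deficiency_vector (h : IsBoundaryPair A Θ.T u w)
    (hS : HasStateForm Θ.S u (u + w)) {z : ℂ} (hz : z.im ≠ 0) :
    ∃ n : HPlus A, HPlus.star A n = z • HPlus.incl A n ∧ u n - w n = -1 := by
  obtain ⟨f, hf1, hf2⟩ := h.exists_left
  obtain ⟨g, hg1, hg2⟩ := exists_sub_smul_eq h hS hz (HPlus.star A f - z • HPlus.incl A f)
  refine ⟨f - g, ?_, ?_⟩
  · rw [map_sub, map_sub, smul_sub]
    rw [sub_eq_iff_eq_add] at hg1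
    rw [hg1]; abel
  · rw [map_sub, map_sub, hf1, hf2, hg2]; ring

theorem norm_lt_of_im_neg (h : IsBoundaryPair A T u w) {z : ℂ} (hz : z.im < 0) {n : HPlus A}
    (hn : HPlus.star A n = z • HPlus.incl A n) (hne : u n - w n = -1) : ‖w n‖ < ‖u n‖ := by
  have hn0 : HPlus.incl A n ≠ 0 := by
    intro h0
    have : n = 0 := HPlus.incl_injective A (by rw [h0, map_zero])
    rw [this, map_zero, map_zero] at hne
    norm_num at hne
  have h1 := h.im_mul_norm_sq hn
  have h2 : 0 < ‖HPlus.incl A n‖ ^ 2 := by positivity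
  refine lt_of_pow_lt_pow_left₀ 2 (norm_nonneg _) ?_
  nlinarith

theorem norm_lt_of_im_pos (h : IsBoundaryPair A T u w) {z : ℂ} (hz : 0 < z.im) {n : HPlus A}
    (hn : HPlus.star A n = z • HPlus.incl A n) (hne : u n - w n = -1) : ‖u n‖ < ‖w n‖ := by
  have hn0 : HPlus.incl A n ≠ 0 := by
    intro h0
    have : n = 0 := HPlus.incl_injective A (by rw [h0, map_zero])
    rw [this, map_zero, map_zero] at hne
    norm_num at hne
  have h1 := h.im_mul_norm_sq hn
  have h2 : 0 < ‖HPlus.incl A n‖ ^ 2 := by positivity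
  refine lt_of_pow_lt_pow_left₀ 2 (norm_nonneg _) ?_
  nlinarith

/-- The lower half-plane is contained in the resolvent set of the main operator. -/
theorem mem_resolventSet_of_im_neg (Θ : ScalarLSystem A) {z : ℂ} (hz : z.im < 0) :
    z ∈ resolventSet Θ.T := by
  obtain ⟨u, w, h, hS, -⟩ := Θ.exists_isBoundaryPair
  obtain ⟨n, hn, hne⟩ := exists_deficiency_vector h hS hz.ne
  have hun : u n ≠ 0 :=
    norm_pos_iff.1 ((norm_nonneg _).trans_lt (norm_lt_of_im_neg h hz hn hne))
  refine mem_resolventSet_of_surjective (abs_pos.2 hz.ne) (fun x => ?_) fun y => ?_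
  · obtain ⟨f, hf1, hf2⟩ := HPlus.exists_of_le Θ.memLambda.quasi.le_adjoint x
    have hu : u f = 0 := (h.mem_domain_iff f).1 (by rw [hf1]; exact x.2)
    refine abs_im_mul_norm_le ?_
    have h1 := h.green f f
    rw [hu, zero_mul, sub_zero, Complex.mul_conj', hf1, hf2, ← inner_conj_symm (Θ.T x),
      Complex.sub_conj] at h1
    -- T is dissipative: the Green identity on ker u gives Im (Tx, x) = |w(f)|² ≥ 0.
    have h2 : ((inner ℂ (x : H) (Θ.T x)).im : ℂ) = ((‖w f‖ ^ 2 : ℝ) : ℂ) := by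
      refine mul_left_cancel₀ (a := 2 * I) (by simp) ?_
      push_cast at h1 ⊢
      linear_combination h1
    rw [Complex.ofReal_inj] at h2
    rw [h2]
    have : 0 ≤ ‖w f‖ ^ 2 := by positivity
    nlinarith
  -- Solve with the quasi-kernel, then subtract a multiple of the deficiency vector n, which A* − z
  -- does not see, to reach ker u = dom T.
  · obtain ⟨g, hg, -⟩ := exists_sub_smul_eq h hS hz.ne y
    have h1 : HPlus.incl A (g - (u g / u n) • n) ∈ Θ.T.domain := by
      rw [h.mem_domain_iff]
      simp [hun]
    refine ⟨⟨_, h1⟩, ?_⟩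
    rw [← HPlus.star_eq_of_le Θ.memLambda.quasi.le_adjoint _ ⟨_, h1⟩ rfl, ← hg]
    simp only [map_sub, map_smul, hn, smul_sub]
    rw [smul_comm z (u g / u n)]
    abel

/-- The Cayley transform `τ` of the impedance function, and its relation to the transfer
function. -/
theorem exists_cayley (Θ : ScalarLSystem A) {z : ℂ} (hz : 0 < z.im) :
    ∃ τ : ℂ, ‖τ‖ < 1 ∧ Θ.impedance z = I * (1 + τ) / (1 - τ) ∧
      Θ.transfer (conj z) = -conj τ := by
  obtain ⟨u, w, h, hS, hK⟩ := Θ.exists_isBoundaryPair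
  have hz' : (conj z).im < 0 := by simpa using hz
  obtain ⟨n, hn, hne⟩ := exists_deficiency_vector h hS hz.ne'
  obtain ⟨m, hm, hme⟩ := exists_deficiency_vector h hS hz'.ne
  have hlt := norm_lt_of_im_pos h hz hn hne
  have hlt' := norm_lt_of_im_neg h hz' hm hme
  have hwn : w n ≠ 0 := norm_pos_iff.1 ((norm_nonneg _).trans_lt hlt)
  have hum : u m ≠ 0 := norm_pos_iff.1 ((norm_nonneg _).trans_lt hlt')
  have hne0 : u n - w n ≠ 0 := by rw [hne]; simp
  -- τ is the quotient u/w on Ker(A* − z), where |u| < |w| because Im z > 0.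
  refine ⟨u n / w n, ?_, ?_, ?_⟩
  · rw [norm_div, div_lt_one (norm_pos_iff.2 hwn)]; exact hlt
  · rw [impedance_eq h hS hK hz.ne' hn hne0]
    have h1 : 1 - u n / w n ≠ 0 := by
      rw [one_sub_div hwn]
      exact div_ne_zero (by rw [← neg_sub]; exact neg_ne_zero.2 hne0) hwn
    rw [div_eq_div_iff hne0 h1]
    field_simp
    ring
  · rw [transfer_eq h hS hK (Θ.mem_resolventSet_of_im_neg hz') hm hum, map_div₀]
    congr 1
    have h1 := congrArg (starRingEnd ℂ) (h.conj_mul_eq hn hm)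
    rw [map_mul, map_mul, Complex.conj_conj, Complex.conj_conj] at h1
    rw [div_eq_div_iff hum (by simpa using hwn)]
    linear_combination h1

end ScalarLSystem

/-! ### The L-system of a boundary pair -/

/-- The antilinear functional `conj(k) ∈ H₋`. -/
noncomputable def conjFunctional (k : HPlus A →L[ℂ] ℂ) : HMinus A :=
  (innerSLFlip ℂ (1 : ℂ)).comp k

theorem conjFunctional_apply (k : HPlus A →L[ℂ] ℂ) (f : HPlus A) :
    conjFunctional k f = conj (k f) := by
  simp [conjFunctional]

/-- `A*` as an element of `[H₊, H₋]`. -/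
noncomputable def starOp (A : H →ₗ.[ℂ] H) : HPlus A →L[ℂ] HMinus A :=
  LinearMap.mkContinuous₂
    (LinearMap.mk₂'ₛₗ (RingHom.id ℂ) (starRingEnd ℂ)
      (fun f g : HPlus A => inner ℂ (HPlus.incl A g) (HPlus.star A f))
      (fun f₁ f₂ g => by simp) (fun c f g => by simp) (fun f g₁ g₂ => by simp)
      (fun c f g => by simp [mul_comm]))
    (‖HPlus.incl A‖ * ‖HPlus.star A‖)
    (fun f g => by
      simp only [LinearMap.mk₂'ₛₗ_apply]
      calc ‖inner ℂ (HPlus.incl A g) (HPlus.star A f)‖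
          ≤ ‖HPlus.incl A g‖ * ‖HPlus.star A f‖ := norm_inner_le_norm _ _
        _ ≤ (‖HPlus.incl A‖ * ‖g‖) * (‖HPlus.star A‖ * ‖f‖) := by
            gcongr
            · exact (HPlus.incl A).le_opNorm g
            · exact (HPlus.star A).le_opNorm f
        _ = ‖HPlus.incl A‖ * ‖HPlus.star A‖ * ‖f‖ * ‖g‖ := by ring)

theorem starOp_apply (f g : HPlus A) :
    starOp A f g = inner ℂ (HPlus.incl A g) (HPlus.star A f) := rfl

/-- `S f = A* f + 2i u(f) conj(k)`. -/
noncomputable def stateOp (u k : HPlus A →L[ℂ] ℂ) : HPlus A →L[ℂ] HMinus A :=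
  starOp A + ((2 * I) • u).smulRight (conjFunctional k)

theorem hasStateForm_stateOp (u k : HPlus A →L[ℂ] ℂ) : HasStateForm (stateOp u k) u k := by
  intro f g
  rw [stateOp, add_apply, add_apply, starOp_apply]
  simp [conjFunctional_apply]

/-- `K c = c conj(k)`. -/
noncomputable def channelOp (k : HPlus A →L[ℂ] ℂ) : ℂ →L[ℂ] HMinus A :=
  (1 : ℂ →L[ℂ] ℂ).smulRight (conjFunctional k)

theorem channelOp_apply (k : HPlus A →L[ℂ] ℂ) (c : ℂ) (g : HPlus A) :
    channelOp k c g = c * conj (k g) := by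
  simp [channelOp, conjFunctional_apply]

theorem chanAdj_channelOp (k : HPlus A →L[ℂ] ℂ) : chanAdj (channelOp k) = k := by
  ext g
  have h1 := apply_eq_of_chanAdj (channelOp k) 1 g
  rw [channelOp_apply, one_mul, one_mul] at h1
  exact (starRingEnd ℂ).injective h1.symm

theorem adj_rePart (S : HPlus A →L[ℂ] HMinus A) : adj (rePart S) = rePart S := by
  ext f g
  rw [adj_apply, rePart_apply, rePart_apply, map_div₀, map_add, Complex.conj_conj,
    Complex.conj_ofNat, add_comm]

namespace IsBoundaryPair

variable {u w : HPlus A →L[ℂ] ℂ}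

theorem adj_apply_of_hasStateForm (h : IsBoundaryPair A T u w) {S : HPlus A →L[ℂ] HMinus A}
    (hS : HasStateForm S u (u + w)) (f g : HPlus A) : adj S f g =
      inner ℂ (HPlus.incl A g) (HPlus.star A f) - 2 * I * w f * conj ((u + w) g) := by
  have h1 := h.green f g
  rw [adj_apply, hS]
  simp only [map_add, map_mul, inner_conj_symm, Complex.conj_I, Complex.conj_conj,
    Complex.conj_ofNat, add_apply]
  linear_combination -h1

theorem imPart_of_hasStateForm (h : IsBoundaryPair A T u w) {S : HPlus A →L[ℂ] HMinus A}
    (hS : HasStateForm S u (u + w)) :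
    imPart S = (channelOp (u + w)).comp (chanAdj (channelOp (u + w))) := by
  ext f g
  rw [imPart_apply, ← adj_apply, h.adj_apply_of_hasStateForm hS, hS,
    ContinuousLinearMap.comp_apply, channelOp_apply, chanAdj_channelOp]
  simp only [add_apply]
  field_simp
  ring

/-- The quasi-kernel is A* on ker(u − w), where the Green form vanishes, so it is symmetric.
Conversely, f₀ + f₁ has u = w = 1, and pairing an element g of the adjoint's domain with it forces
w(g) = u(g). -/
theorem isSelfAdjoint_quasiKernel (h : IsBoundaryPair A T u w) (hA : Dense (A.domain : Set H))
    (hT : MemLambda A T) {S : HPlus A →L[ℂ] HMinus A} (hS : HasStateForm S u (u + w)) :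
    IsSelfAdjoint (quasiKernel (rePart S)) := by
  have hsymm := hT.quasi.le_adjoint_self
  have hgr := mem_quasiKernel_graph_iff hA (rePart_apply_of_hasStateForm h.green hS)
    (h.add_eq_zero_of_mem hT.domain_eq) h.exists_add_ne_zero hsymm
  have hAmem : ∀ a : A.domain, ((a : H), A a) ∈ (quasiKernel (rePart S)).graph := by
    intro a
    obtain ⟨f, hf1, hf2⟩ := HPlus.exists_of_le hsymm a
    have hd : HPlus.incl A f ∈ T.domain ⊓ T†.domain := by
      rw [← hT.domain_eq, hf1]; exact a.2
    refine (hgr _).2 ⟨f, ?_, hf1, hf2⟩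
    simp [(h.mem_domain_iff f).1 hd.1, (h.mem_adjoint_domain_iff f).1 hd.2]
  have hdense : Dense ((quasiKernel (rePart S)).domain : Set H) :=
    hA.mono fun a ha => LinearPMap.mem_domain_of_mem_graph (hAmem ⟨a, ha⟩)
  rw [LinearPMap.isSelfAdjoint_def]
  refine LinearPMap.eq_of_eq_graph ?_
  rw [LinearPMap.adjoint_graph_eq_graph_adjoint hdense]
  ext p
  rw [Submodule.mem_adjoint_iff]
  constructor
  · intro hp
    obtain ⟨g, hg1, hg2⟩ := HPlus.exists_incl_eq hA (x := p.1) (y := p.2) fun a => by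
      have h1 := congrArg (starRingEnd ℂ) (sub_eq_zero.1 (hp _ _ (hAmem a)))
      rw [inner_conj_symm, inner_conj_symm] at h1
      exact h1.symm
    refine (hgr p).2 ⟨g, ?_, hg1, hg2⟩
    obtain ⟨f₀, hu₀, hw₀⟩ := h.exists_left
    obtain ⟨f₁, hw₁, hu₁⟩ := h.exists_right
    have h2 := hp (HPlus.incl A (f₀ + f₁)) (HPlus.star A (f₀ + f₁))
      ((hgr _).2 ⟨f₀ + f₁, by simp [hu₀, hw₀, hw₁, hu₁], rfl, rfl⟩)
    have h3 := h.green g (f₀ + f₁)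
    rw [hg1, hg2] at h3
    have h4 : inner ℂ (HPlus.incl A (f₀ + f₁)) p.2 - inner ℂ (HPlus.star A (f₀ + f₁)) p.1 = 0 := by
      rw [← h2]
      linear_combination -2 * h2
    rw [h4] at h3
    simp only [map_add, hu₀, hw₀, hw₁, hu₁] at h3
    have h5 : w g - u g = 0 := by
      have := mul_eq_zero.1 h3.symm
      simpa using this
    simp only [smul_apply, sub_apply, smul_eq_mul]
    linear_combination (-I) * h5
  · intro hp a b hab
    obtain ⟨f, hf1, hf2, hf3⟩ := (hgr _).1 hab
    obtain ⟨g, hg1, hg2, hg3⟩ := (hgr _).1 hp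
    simp only [smul_apply, sub_apply, smul_eq_mul, mul_eq_zero, Complex.I_ne_zero, false_or,
      sub_eq_zero] at hf1 hg1
    simp only at hf2 hf3
    have h1 := h.green g f
    rw [← hf2, ← hf3, ← hg2, ← hg3]
    rw [hf1, hg1, sub_self, mul_zero] at h1
    linear_combination -h1

theorem extends_stateForm (h : IsBoundaryPair A T u w) (hq : IsQuasiSelfAdjointExt A T)
    {S : HPlus A →L[ℂ] HMinus A} (hS : HasStateForm S u (u + w)) : Extends S T := by
  intro x
  obtain ⟨f, hf1, hf2⟩ := HPlus.exists_of_le hq.le_adjoint x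
  refine ⟨f, hf1, ?_⟩
  ext g
  rw [hS, (h.mem_domain_iff f).1 (by rw [hf1]; exact x.2), emb_apply, hf2]
  simp

theorem extends_adj_stateForm (h : IsBoundaryPair A T u w) (hq : T† ≤ A†)
    {S : HPlus A →L[ℂ] HMinus A} (hS : HasStateForm S u (u + w)) : Extends (adj S) T† := by
  intro x
  obtain ⟨f, hf1, hf2⟩ := HPlus.exists_of_le hq x
  refine ⟨f, hf1, ?_⟩
  ext g
  rw [h.adj_apply_of_hasStateForm hS, (h.mem_adjoint_domain_iff f).1 (by rw [hf1]; exact x.2),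
    emb_apply, hf2]
  simp

theorem extends_rePart (h : IsBoundaryPair A T u w) (hT : MemLambda A T)
    {S : HPlus A →L[ℂ] HMinus A} (hS : HasStateForm S u (u + w)) : Extends (rePart S) A := by
  intro x
  obtain ⟨f, hf1, hf2⟩ := HPlus.exists_of_le hT.quasi.le_adjoint_self x
  have hd : HPlus.incl A f ∈ T.domain ⊓ T†.domain := by
    rw [← hT.domain_eq, hf1]; exact x.2
  refine ⟨f, hf1, ?_⟩
  ext g
  rw [rePart_apply_of_hasStateForm h.green hS, emb_apply, hf2]
  simp [(h.mem_domain_iff f).1 hd.1, (h.mem_adjoint_domain_iff f).1 hd.2]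

theorem range_channelOp (h : IsBoundaryPair A T u w) {S : HPlus A →L[ℂ] HMinus A}
    (hS : HasStateForm S u (u + w)) : Set.range (channelOp (u + w)) = Set.range (imPart S) := by
  rw [h.imPart_of_hasStateForm hS, chanAdj_channelOp]
  obtain ⟨f, hf⟩ := h.exists_add_ne_zero
  have hsurj : Function.Surjective (u + w) := fun c =>
    ⟨(c / (u + w) f) • f, by rw [map_smul, smul_eq_mul, div_mul_cancel₀ _ hf]⟩
  rw [ContinuousLinearMap.coe_comp, hsurj.range_comp]

/-- The L-system with main operator `T` given by a boundary pair. -/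
noncomputable def system (h : IsBoundaryPair A T u w) (hA : IsSymmOp A) (hT : MemLambda A T) :
    ScalarLSystem A where
  T := T
  S := stateOp u (u + w)
  K := channelOp (u + w)
  isSymmOp := hA
  memLambda := hT
  isStarExt :=
    { quasi := hT.quasi
      resolvent := hT.resolvent
      biExt := ⟨h.extends_stateForm hT.quasi (hasStateForm_stateOp _ _),
        h.extends_adj_stateForm (adjoint_le_adjoint hA.dense hT.quasi.le)
          (hasStateForm_stateOp _ _)⟩
      re :=
        { adj_eq := adj_rePart _
          ext := h.extends_rePart hT (hasStateForm_stateOp _ _)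
          quasiKernel_selfAdjoint :=
            h.isSelfAdjoint_quasiKernel hA.dense hT (hasStateForm_stateOp _ _) } }
  imPart_eq := h.imPart_of_hasStateForm (hasStateForm_stateOp _ _)
  range_eq := h.range_channelOp (hasStateForm_stateOp _ _)

end IsBoundaryPair

end LSys

/-! ### Rotation and uniqueness of boundary pairs -/

namespace LSys

variable {H : Type u} [NormedAddCommGroup H] [InnerProductSpace ℂ H] [CompleteSpace H]
  {A T : H →ₗ.[ℂ] H}

open Complex (I)

namespace IsBoundaryPair

variable {u w u' w' : HPlus A →L[ℂ] ℂ}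

/-- Only the product w(f) conj w(g) and the kernel of w enter the definition, and neither changes
under a unimodular factor. -/
theorem rotate (h : IsBoundaryPair A T u w) {ω : ℂ} (hω : ‖ω‖ = 1) :
    IsBoundaryPair A T u (ω • w) := by
  have hω0 : ω ≠ 0 := norm_pos_iff.1 (by rw [hω]; exact one_pos)
  have hωω : ω * conj ω = 1 := by rw [Complex.mul_conj', hω]; simp
  refine ⟨fun f g => ?_, h.mem_domain_iff, fun f => ?_, ?_, ?_⟩
  · rw [h.green]
    simp only [smul_apply, smul_eq_mul, map_mul]
    linear_combination (-2 * I * w f * conj (w g)) * hωω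
  · rw [h.mem_adjoint_domain_iff]
    simp [hω0]
  · obtain ⟨f, h1, h2⟩ := h.exists_left
    exact ⟨ω⁻¹ • f, by simp [h1], by simp [h2, hω0]⟩
  · obtain ⟨f, h1, h2⟩ := h.exists_right
    exact ⟨f, by simp [h1], h2⟩

/-- The kernels are prescribed by T and T*, so corresponding functionals are proportional. Green's
identity at f₁ and at f₀ gives the factors modulus one. -/
theorem exists_eq_smul (h : IsBoundaryPair A T u w) (h' : IsBoundaryPair A T u' w') :
    ∃ a b : ℂ, ‖a‖ = 1 ∧ ‖b‖ = 1 ∧ u' = a • u ∧ w' = b • w := by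
  obtain ⟨f₀, hu₀, hw₀⟩ := h.exists_left
  obtain ⟨f₁, hw₁, hu₁⟩ := h.exists_right
  have hu : ∀ f, u f = 0 → u' f = 0 := fun f hf =>
    (h'.mem_domain_iff f).1 ((h.mem_domain_iff f).2 hf)
  have hw : ∀ f, w f = 0 → w' f = 0 := fun f hf =>
    (h'.mem_adjoint_domain_iff f).1 ((h.mem_adjoint_domain_iff f).2 hf)
  have hnorm : ∀ c : ℂ, c * conj c = 1 → ‖c‖ = 1 := fun c hc => by
    rw [Complex.mul_conj'] at hc
    have : ‖c‖ ^ 2 = 1 := by exact_mod_cast hc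
    exact (pow_eq_one_iff_of_nonneg (norm_nonneg _) two_ne_zero).1 this
  have h2I : (2 * I : ℂ) ≠ 0 := by simp
  refine ⟨u' f₁, w' f₀, hnorm _ ?_, hnorm _ ?_, ?_, ?_⟩
  · have h1 := (h'.green f₁ f₁).symm.trans (h.green f₁ f₁)
    rw [hw _ hw₁, hw₁, hu₁, map_one] at h1
    have := mul_left_cancel₀ h2I h1
    linear_combination -this
  · have h1 := (h'.green f₀ f₀).symm.trans (h.green f₀ f₀)
    rw [hu _ hu₀, hu₀, hw₀, map_one] at h1
    have := mul_left_cancel₀ h2I h1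
    linear_combination this
  · ext f
    have := hu (f - u f • f₁) (by simp [hu₁])
    rw [map_sub, map_smul, sub_eq_zero] at this
    rw [this, smul_apply, smul_eq_mul, smul_eq_mul, mul_comm]
  · ext f
    have := hw (f - w f • f₀) (by simp [hw₀])
    rw [map_sub, map_smul, sub_eq_zero] at this
    rw [this, smul_apply, smul_eq_mul, smul_eq_mul, mul_comm]

/-- T itself replaces the quasi-kernel in the subtraction argument, so z may be any point of ρ(T),
also a real one. -/
theorem exists_deficiency_vector_of_mem_resolventSet (h : IsBoundaryPair A T u w)
    (hT : T ≤ A†) {z : ℂ} (hz : z ∈ resolventSet T) :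
    ∃ n : HPlus A, HPlus.star A n = z • HPlus.incl A n ∧ u n = 1 := by
  obtain ⟨f, -, hu⟩ := h.exists_right
  obtain ⟨R, hR, -⟩ := hz
  obtain ⟨x, -, hx⟩ := hR (HPlus.star A f - z • HPlus.incl A f)
  obtain ⟨g, hg1, hg2⟩ := HPlus.exists_of_le hT x
  refine ⟨f - g, ?_, ?_⟩
  · rw [map_sub, map_sub, smul_sub, hg1, hg2]
    rw [sub_eq_iff_eq_add] at hx
    rw [hx]; abel
  · rw [map_sub, hu, (h.mem_domain_iff g).1 (by rw [hg1]; exact x.2), sub_zero]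

end IsBoundaryPair

namespace ScalarLSystem

theorem exists_rotate (Θ : ScalarLSystem A) {ω : ℂ} (hω : ‖ω‖ = 1) :
    ∃ Θ' : ScalarLSystem A, Θ'.T = Θ.T ∧
      ∀ z ∈ resolventSet Θ.T, Θ'.transfer z = Θ.transfer z * ω := by
  obtain ⟨u, w, h, hS, hK⟩ := Θ.exists_isBoundaryPair
  have h' := h.rotate hω
  refine ⟨h'.system Θ.isSymmOp Θ.memLambda, rfl, fun z hz => ?_⟩
  obtain ⟨n, hn, hun⟩ := h.exists_deficiency_vector_of_mem_resolventSet
    Θ.memLambda.quasi.le_adjoint hz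
  have hun0 : u n ≠ 0 := by rw [hun]; exact one_ne_zero
  rw [transfer_eq h hS hK hz hn hun0,
    transfer_eq (Θ := h'.system Θ.isSymmOp Θ.memLambda) h' (hasStateForm_stateOp _ _)
      (chanAdj_channelOp _) hz hn hun0, smul_apply, smul_eq_mul]
  ring

/-- The pairs are related by unimodular factors a and b, which multiply W = −w/u by b/a. Equality at
one point with W ≠ 0 gives a = b. The common factor cancels in u(·) conj k and appears in K as conj
a. -/
theorem eq_of_transfer_eq (Θ₁ Θ₂ : ScalarLSystem A) (hT : Θ₁.T = Θ₂.T) {z : ℂ}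
    (hz : z ∈ resolventSet Θ₂.T) (hW : Θ₁.transfer z = Θ₂.transfer z)
    (h0 : Θ₂.transfer z ≠ 0) : Θ₁.S = Θ₂.S ∧ ∃ c : ℂ, ‖c‖ = 1 ∧ Θ₁.K = c • Θ₂.K := by
  obtain ⟨u₁, w₁, h₁, hS₁, hK₁⟩ := Θ₁.exists_isBoundaryPair
  obtain ⟨u₂, w₂, h₂, hS₂, hK₂⟩ := Θ₂.exists_isBoundaryPair
  have hz₁ : z ∈ resolventSet Θ₁.T := by rwa [hT]
  obtain ⟨a, b, ha, hb, hu, hw⟩ := h₂.exists_eq_smul (hT ▸ h₁)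
  obtain ⟨n, hn, hun⟩ := h₂.exists_deficiency_vector_of_mem_resolventSet
    Θ₂.memLambda.quasi.le_adjoint hz
  have ha0 : a ≠ 0 := norm_pos_iff.1 (by rw [ha]; exact one_pos)
  have hab : a = b := by
    rw [transfer_eq h₁ hS₁ hK₁ hz₁ hn (by rw [hu]; simp [hun, ha0]),
      transfer_eq h₂ hS₂ hK₂ hz hn (by simp [hun]), hu, hw] at hW
    rw [transfer_eq h₂ hS₂ hK₂ hz hn (by simp [hun])] at h0
    simp only [smul_apply, smul_eq_mul, hun, mul_one, div_one, neg_inj] at hW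
    have hwn : w₂ n ≠ 0 := by simpa [hun] using h0
    rw [div_eq_iff ha0, mul_comm (w₂ n)] at hW
    exact (mul_right_cancel₀ hwn hW).symm
  have hk : u₁ + w₁ = a • (u₂ + w₂) := by rw [hu, hw, ← hab, smul_add]
  refine ⟨?_, conj a, by rwa [RCLike.norm_conj], ?_⟩
  · have haa : a * conj a = 1 := by rw [Complex.mul_conj', ha]; simp
    ext f g
    rw [hS₁, hS₂, hk, hu]
    simp only [smul_apply, smul_eq_mul, map_mul]
    linear_combination (2 * I * u₂ f * conj ((u₂ + w₂) g)) * haa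
  · ext g
    rw [apply_eq_of_chanAdj, hK₁, hk, smul_apply, smul_apply, smul_apply, apply_eq_of_chanAdj, hK₂]
    simp only [smul_eq_mul, map_mul]
    ring

end ScalarLSystem

end LSys

/-! ### Donoghue classes in terms of finite measures -/

namespace LSys

open Complex (I)
open MeasureTheory

/-- The kernel `(1 + t z) / (t - z)` of the Nevanlinna representation by a finite measure. -/
noncomputable def nevanlinnaKernel (z : ℂ) (t : ℝ) : ℂ := (1 + t * z) / (t - z)

theorem ofReal_sub_ne_zero {z : ℂ} (hz : 0 < z.im) (t : ℝ) : (t : ℂ) - z ≠ 0 := by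
  intro h
  have := congrArg Complex.im h
  simp at this
  exact hz.ne' this

theorem im_le_norm_ofReal_sub {z : ℂ} (hz : 0 < z.im) (t : ℝ) : z.im ≤ ‖(t : ℂ) - z‖ := by
  have := Complex.abs_im_le_norm ((t : ℂ) - z)
  simpa [abs_of_pos hz] using this

theorem nevanlinnaKernel_eq {z : ℂ} (hz : 0 < z.im) (t : ℝ) :
    nevanlinnaKernel z t = z + (1 + z ^ 2) * ((t : ℂ) - z)⁻¹ := by
  have := ofReal_sub_ne_zero hz t
  rw [nevanlinnaKernel]
  field_simp
  ring

theorem nevanlinnaKernel_mul {z : ℂ} (hz : 0 < z.im) (t : ℝ) :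
    1 / ((t : ℂ) - z) - (t : ℂ) / (1 + (t : ℂ) ^ 2) =
      ((1 / (1 + t ^ 2) : ℝ) : ℂ) * nevanlinnaKernel z t := by
  have h1 := ofReal_sub_ne_zero hz t
  have h2 : (1 + (t : ℂ) ^ 2) ≠ 0 := by
    have : (1 + t ^ 2 : ℝ) ≠ 0 := by positivity
    exact_mod_cast this
  rw [nevanlinnaKernel]
  push_cast
  field_simp
  ring

theorem continuous_inv_ofReal_sub {z : ℂ} (hz : 0 < z.im) :
    Continuous fun t : ℝ => ((t : ℂ) - z)⁻¹ :=
  (by fun_prop : Continuous fun t : ℝ => (t : ℂ) - z).inv₀ (ofReal_sub_ne_zero hz)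

theorem integrable_inv_ofReal_sub {σ : Measure ℝ} [IsFiniteMeasure σ] {z : ℂ} (hz : 0 < z.im) :
    Integrable (fun t : ℝ => ((t : ℂ) - z)⁻¹) σ := by
  refine Integrable.of_bound (continuous_inv_ofReal_sub hz).aestronglyMeasurable z.im⁻¹
    (.of_forall fun t => ?_)
  rw [norm_inv]
  exact inv_anti₀ hz (im_le_norm_ofReal_sub hz t)

theorem integrable_nevanlinnaKernel {σ : Measure ℝ} [IsFiniteMeasure σ] {z : ℂ}
    (hz : 0 < z.im) : Integrable (nevanlinnaKernel z) σ := by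
  rw [show nevanlinnaKernel z = fun t : ℝ => z + (1 + z ^ 2) * ((t : ℂ) - z)⁻¹ from
    funext (nevanlinnaKernel_eq hz)]
  exact (integrable_const z).add ((integrable_inv_ofReal_sub hz).const_mul _)

theorem differentiableAt_integral_inv_ofReal_sub {σ : Measure ℝ} [IsFiniteMeasure σ] {z : ℂ}
    (hz : 0 < z.im) : DifferentiableAt ℂ (fun z : ℂ => ∫ t : ℝ, ((t : ℂ) - z)⁻¹ ∂σ) z := by
  -- On this half-plane the derivative of the kernel is bounded uniformly in t, which justifies
  -- differentiation under the integral.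
  let s : Set ℂ := {ζ | z.im / 2 < ζ.im}
  have hs : s ∈ nhds z :=
    (isOpen_lt continuous_const Complex.continuous_im).mem_nhds (half_lt_self hz)
  have hpos : ∀ ζ ∈ s, 0 < ζ.im := fun ζ hζ => lt_trans (by positivity) hζ
  refine (hasDerivAt_integral_of_dominated_loc_of_deriv_le (𝕜 := ℂ)
    (F' := fun ζ (t : ℝ) => (((t : ℂ) - ζ) ^ 2)⁻¹) (bound := fun _ => ((z.im / 2) ^ 2)⁻¹) hs
    (Filter.mem_of_superset hs fun ζ hζ =>
      (continuous_inv_ofReal_sub (hpos ζ hζ)).aestronglyMeasurable)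
    (integrable_inv_ofReal_sub hz) ?_ (.of_forall fun t ζ hζ => ?_) (integrable_const _)
    (.of_forall fun t ζ hζ => ?_)).2.differentiableAt
  · exact Continuous.aestronglyMeasurable <|
      (by fun_prop : Continuous fun t : ℝ => ((t : ℂ) - z) ^ 2).inv₀
        fun t => pow_ne_zero 2 (ofReal_sub_ne_zero hz t)
  · rw [norm_inv, norm_pow]
    have h1 := im_le_norm_ofReal_sub (hpos ζ hζ) t
    have h2 : z.im / 2 < ζ.im := hζ
    gcongr
    linarith
  · refine (((hasDerivAt_id ζ).const_sub (t : ℂ)).fun_inv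
      (ofReal_sub_ne_zero (hpos ζ hζ) t)).congr_deriv ?_
    simp

theorem differentiableOn_integral_nevanlinnaKernel {σ : Measure ℝ} [IsFiniteMeasure σ] :
    DifferentiableOn ℂ (fun z => ∫ t, nevanlinnaKernel z t ∂σ) {z | 0 < z.im} := by
  intro z hz
  have h1 : DifferentiableAt ℂ
      (fun z : ℂ => σ.real Set.univ * z + (1 + z ^ 2) * ∫ t : ℝ, ((t : ℂ) - z)⁻¹ ∂σ) z := by
    have := differentiableAt_integral_inv_ofReal_sub (σ := σ) hz
    fun_prop
  refine h1.differentiableWithinAt.congr (fun ζ hζ => ?_) ?_ <;>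
  · rw [integral_congr_ae (.of_forall (nevanlinnaKernel_eq (by assumption))),
      integral_add (integrable_const _) ((integrable_inv_ofReal_sub (by assumption)).const_mul _),
      integral_const_mul, integral_const]
    simp

theorem nevanlinnaKernel_I (t : ℝ) : nevanlinnaKernel I t = I := by
  have h1 := ofReal_sub_ne_zero (z := I) (by simp) t
  rw [nevanlinnaKernel, div_eq_iff h1]
  linear_combination Complex.I_sq

theorem integral_nevanlinnaKernel_I (σ : Measure ℝ) :
    ∫ t, nevanlinnaKernel I t ∂σ = σ.real Set.univ * I := by
  simp [nevanlinnaKernel_I]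

/-- The functions in a Donoghue class, in terms of finite measures. -/
theorem mem_donoghue_iff {Q a : ℝ} {V : ℂ → ℂ} : V ∈ donoghue Q a ↔
    ∃ σ : Measure ℝ, IsFiniteMeasure σ ∧ ∫⁻ t, ENNReal.ofReal (1 + t ^ 2) ∂σ = ⊤ ∧
      σ.real Set.univ = a ∧ ∀ z : ℂ, 0 < z.im → V z = Q + ∫ t, nevanlinnaKernel z t ∂σ := by
  have hm1 : Measurable fun t : ℝ => ENNReal.ofReal (1 + t ^ 2) := by fun_prop
  have hm2 : Measurable fun t : ℝ => ENNReal.ofReal (1 / (1 + t ^ 2)) := by fun_prop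
  have hmul : ∀ t : ℝ, ENNReal.ofReal (1 / (1 + t ^ 2)) * ENNReal.ofReal (1 + t ^ 2) = 1 := by
    intro t
    rw [← ENNReal.ofReal_mul (by positivity), one_div_mul_cancel (by positivity),
      ENNReal.ofReal_one]
  constructor
  · rintro ⟨μ, hμ, hint, ha, hV⟩
    have hfin := isFiniteMeasure_withDensity_ofReal hint.2
    -- dσ = dμ/(1 + t²): the normalization of μ becomes the total mass of σ, and infinite μ becomes
    -- an infinite second moment.
    refine ⟨μ.withDensity fun t => ENNReal.ofReal (1 / (1 + t ^ 2)), hfin, ?_, ?_, ?_⟩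
    · rw [lintegral_withDensity_eq_lintegral_mul _ hm2 hm1]
      simp only [Pi.mul_apply, hmul]
      simpa using hμ
    · rw [measureReal_def, withDensity_apply _ MeasurableSet.univ, Measure.restrict_univ,
        ← ofReal_integral_eq_lintegral_ofReal hint (.of_forall fun t => by positivity), ha,
        ENNReal.toReal_ofReal]
      rw [← ha]
      exact integral_nonneg fun t => by positivity
    · intro z hz
      rw [hV z hz, integral_withDensity_eq_integral_toReal_smul hm2
        (.of_forall fun t => ENNReal.ofReal_lt_top)]
      congr 1
      refine integral_congr_ae (.of_forall fun t => ?_)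
      simp only
      rw [nevanlinnaKernel_mul hz, ENNReal.toReal_ofReal (by positivity), Complex.real_smul]
  · rintro ⟨σ, hσ, htop, ha, hV⟩
    have hcomp : ∀ t : ℝ, (ENNReal.ofReal (1 + t ^ 2)).toReal * (1 / (1 + t ^ 2)) = 1 := by
      intro t
      rw [ENNReal.toReal_ofReal (by positivity), mul_one_div_cancel (by positivity)]
    refine ⟨σ.withDensity fun t => ENNReal.ofReal (1 + t ^ 2), ?_, ?_, ?_, ?_⟩
    · rw [withDensity_apply _ MeasurableSet.univ, Measure.restrict_univ, htop]
    · rw [integrable_withDensity_iff_integrable_smul' hm1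
        (.of_forall fun t => ENNReal.ofReal_lt_top)]
      simp only [smul_eq_mul, hcomp]
      exact integrable_const _
    · rw [integral_withDensity_eq_integral_toReal_smul hm1
        (.of_forall fun t => ENNReal.ofReal_lt_top)]
      simp only [smul_eq_mul, hcomp]
      simp [ha]
    · intro z hz
      rw [hV z hz, integral_withDensity_eq_integral_toReal_smul hm1
        (.of_forall fun t => ENNReal.ofReal_lt_top)]
      congr 1
      refine integral_congr_ae (.of_forall fun t => ?_)
      simp only
      rw [nevanlinnaKernel_mul hz, Complex.real_smul, ← mul_assoc, ← Complex.ofReal_mul, hcomp,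
        Complex.ofReal_one, one_mul]

/-- The kernel is constantly i at z = i. Thus V(i) determines both parameters of the class. -/
theorem apply_I_of_mem_donoghue {Q a : ℝ} {V : ℂ → ℂ} (hV : V ∈ donoghue Q a) :
    V I = Q + a * I := by
  obtain ⟨σ, _, -, ha, h⟩ := mem_donoghue_iff.1 hV
  rw [h I (by simp), integral_nevanlinnaKernel_I, ha]

theorem disjoint_donoghue {Q a b : ℝ} (hab : a ≠ b) : Disjoint (donoghue Q a) (donoghue Q b) := by
  rw [Set.disjoint_left]
  intro V h1 h2
  have := (apply_I_of_mem_donoghue h1).symm.trans (apply_I_of_mem_donoghue h2)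
  refine hab ?_
  simpa using congrArg Complex.im this

end LSys

/-! ### Schwarz formula and Herglotz representation on the disc -/

namespace LSys

open Complex (I)
open MeasureTheory Metric Real

/-- The Schwarz integral formula on the unit circle. -/
theorem circleAverage_schwarz {F : ℂ → ℂ} (hF : DiffContOnCl ℂ F (ball 0 1)) {ζ : ℂ}
    (hζ : ζ ∈ ball (0 : ℂ) 1) :
    circleAverage (fun s => (s + ζ) / (s - ζ) * ((F s).re : ℂ)) 0 1 = F ζ - (F 0).im * I := by
  have hζ1 : ‖ζ‖ < 1 := by simpa using hζ
  have hF' : DiffContOnCl ℂ F (ball 0 |1|) := by simpa using hF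
  have hFc : ContinuousOn F (sphere 0 |1|) := by
    refine hF.continuousOn.mono ?_
    rw [closure_ball 0 one_ne_zero, abs_one]
    exact sphere_subset_closedBall
  have hne : ∀ s ∈ sphere (0 : ℂ) |1|, s - ζ ≠ 0 := by
    intro s hs h
    have : ‖s‖ = 1 := by simpa using hs
    rw [sub_eq_zero.1 h] at this
    linarith
  -- On the circle conj s = 1/s, so the conjugate of this holomorphic function is the Schwarz kernel
  -- times conj F; its mean value is therefore conj F(0).
  have hG : DiffContOnCl ℂ (fun s => (1 + s * conj ζ) / (1 - s * conj ζ) * F s) (ball 0 |1|) := by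
    have h0 : ∀ s ∈ closedBall (0 : ℂ) 1, 1 - s * conj ζ ≠ 0 := by
      intro s hs h
      have hs1 : ‖s‖ ≤ 1 := by simpa using hs
      have h1 : s * conj ζ = 1 := (sub_eq_zero.1 h).symm
      have h2 := congrArg norm h1
      rw [norm_mul, RCLike.norm_conj, norm_one] at h2
      nlinarith [norm_nonneg s, norm_nonneg ζ]
    have h1 : DifferentiableOn ℂ (fun s => (1 + s * conj ζ) / (1 - s * conj ζ))
        (closure (ball 0 |1|)) := by
      rw [abs_one, closure_ball 0 one_ne_zero]
      exact DifferentiableOn.div (by fun_prop) (by fun_prop) h0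
    exact h1.diffContOnCl.smul hF'
  have e1 := DiffContOnCl.circleAverage_smul_div (c := 0) hF' (w := ζ) (by simpa using hζ)
  have e2 := DiffContOnCl.circleAverage hF'
  have e3 := DiffContOnCl.circleAverage hG
  simp only [zero_mul, add_zero, sub_zero, div_one, one_mul, smul_eq_mul] at e1 e2 e3
  have i1 : CircleIntegrable (fun s => s / (s - ζ) * F s) 0 1 := by
    refine ContinuousOn.circleIntegrable' (ContinuousOn.mul ?_ hFc)
    exact ContinuousOn.div (by fun_prop) (by fun_prop) hne
  have i2 : CircleIntegrable F 0 1 := ContinuousOn.circleIntegrable' hFc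
  have hGc : ContinuousOn (fun s => (1 + s * conj ζ) / (1 - s * conj ζ) * F s)
      (sphere 0 |1|) := by
    refine hG.continuousOn.mono ?_
    rw [abs_one, closure_ball 0 one_ne_zero]
    exact sphere_subset_closedBall
  have i3 : CircleIntegrable (fun s => (1 + s * conj ζ) / (1 - s * conj ζ) * F s) 0 1 :=
    ContinuousOn.circleIntegrable' hGc
  have e4 : circleAverage (fun s => conj ((1 + s * conj ζ) / (1 - s * conj ζ) * F s)) 0 1 =
      conj (F 0) := by
    rw [← e3]
    exact (Complex.conjCLE.toContinuousLinearMap).circleAverage_comp_comm i3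
  have i4 : CircleIntegrable (fun s => conj ((1 + s * conj ζ) / (1 - s * conj ζ) * F s)) 0 1 :=
    ContinuousOn.circleIntegrable' (Complex.continuous_conj.comp_continuousOn hGc)
  -- Write the kernel as 2s/(s − ζ) − 1 and Re F as (F + conj F)/2. The three averages are evaluated
  -- by Cauchy's formula, the mean value property and its conjugate.
  have hcongr : Set.EqOn (fun s => (s + ζ) / (s - ζ) * ((F s).re : ℂ))
      (fun s => (s / (s - ζ) * F s + (-(1 / 2 : ℂ)) • F s) +
        (1 / 2 : ℂ) • conj ((1 + s * conj ζ) / (1 - s * conj ζ) * F s)) (sphere 0 |1|) := by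
    intro s hs
    have hs1 : ‖s‖ = 1 := by simpa using hs
    have hss : s * conj s = 1 := by rw [Complex.mul_conj', hs1]; simp
    have hs0 : s ≠ 0 := norm_pos_iff.1 (by rw [hs1]; exact one_pos)
    have hsz := hne s hs
    have h1 : conj s = s⁻¹ := eq_inv_of_mul_eq_one_right hss
    have h2 : conj ((1 + s * conj ζ) / (1 - s * conj ζ)) = (s + ζ) / (s - ζ) := by
      rw [map_div₀, map_add, map_sub, map_mul, Complex.conj_conj, map_one, h1]
      field_simp
    simp only [map_mul, h2, smul_eq_mul, Complex.re_eq_add_conj]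
    field_simp
    ring
  rw [circleAverage_congr_sphere hcongr]
  have j2 : CircleIntegrable (fun s => (-(1 / 2 : ℂ)) • F s) 0 1 := i2.const_smul
  have j4 : CircleIntegrable
      (fun s => (1 / 2 : ℂ) • conj ((1 + s * conj ζ) / (1 - s * conj ζ) * F s)) 0 1 :=
    i4.const_smul
  rw [circleAverage_fun_add (f₁ := fun s => s / (s - ζ) * F s + (-(1 / 2 : ℂ)) • F s)
      (i1.add j2) j4, circleAverage_fun_add i1 j2, circleAverage_fun_smul,
    circleAverage_fun_smul, e1, e2, e4]
  simp only [smul_eq_mul]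
  have h5 := Complex.sub_conj (F 0)
  push_cast at h5
  linear_combination (-1 / 2 : ℂ) * h5

/-- The measure is h dθ/2π pushed forward to the circle, a compact space on which measures of fixed
mass form a weakly compact set. -/
theorem exists_finiteMeasure_circle {h : ℂ → ℝ} (hc : ContinuousOn h (sphere 0 1))
    (h0 : ∀ s ∈ sphere (0 : ℂ) 1, 0 ≤ h s) : ∃ σ : FiniteMeasure (sphere (0 : ℂ) 1),
      ∀ g : ℂ → ℂ, ContinuousOn g (sphere 0 1) →
        ∫ s : sphere (0 : ℂ) 1, g s ∂(σ : Measure (sphere (0 : ℂ) 1)) = circleAverage (fun s => g s * h s) 0 1 := by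
  let d : ℝ → ℝ := fun θ => (2 * π)⁻¹ * h (circleMap 0 1 θ)
  have hmem : ∀ θ, circleMap 0 1 θ ∈ sphere (0 : ℂ) 1 := circleMap_mem_sphere 0 zero_le_one
  have hd : Continuous d :=
    continuous_const.mul (hc.comp_continuous (continuous_circleMap 0 1) hmem)
  have hd0 : ∀ θ, 0 ≤ d θ := fun θ => mul_nonneg (by positivity) (h0 _ (hmem θ))
  have hdm : Measurable fun θ => ENNReal.ofReal (d θ) := hd.measurable.ennreal_ofReal
  let e : ℝ → sphere (0 : ℂ) 1 := fun θ => ⟨circleMap 0 1 θ, hmem θ⟩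
  have he : Continuous e := (continuous_circleMap 0 1).subtype_mk hmem
  let ν : Measure ℝ :=
    (volume.restrict (Set.Ioc 0 (2 * π))).withDensity fun θ => ENNReal.ofReal (d θ)
  have hν : IsFiniteMeasure ν := isFiniteMeasure_withDensity_ofReal
    (hd.integrableOn_Ioc (μ := volume)).2
  refine ⟨⟨ν.map e, inferInstance⟩, fun g hg => ?_⟩
  have hgc : Continuous fun s : sphere (0 : ℂ) 1 => g s :=
    hg.comp_continuous continuous_subtype_val fun s => s.2
  rw [FiniteMeasure.toMeasure_mk, integral_map he.aemeasurable
      hgc.aestronglyMeasurable, integral_withDensity_eq_integral_toReal_smul hdm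
      (.of_forall fun θ => ENNReal.ofReal_lt_top), circleAverage_def,
    intervalIntegral.integral_of_le (by positivity), ← integral_smul]
  refine integral_congr_ae (.of_forall fun θ => ?_)
  simp only
  rw [ENNReal.toReal_ofReal (hd0 θ)]
  simp only [d, e, Complex.real_smul]
  push_cast
  ring

/-- The Herglotz representation theorem. -/
theorem exists_herglotz_measure {F : ℂ → ℂ} (hF : DifferentiableOn ℂ F (ball 0 1))
    (hpos : ∀ ζ ∈ ball (0 : ℂ) 1, 0 ≤ (F ζ).re) : ∃ σ : FiniteMeasure (sphere (0 : ℂ) 1),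
      ∀ ζ ∈ ball (0 : ℂ) 1,
        F ζ = (F 0).im * I + ∫ s : sphere (0 : ℂ) 1, ((s : ℂ) + ζ) / (s - ζ) ∂(σ : Measure (sphere (0 : ℂ) 1)) := by
  have hmaps : ∀ r ∈ Set.Ioo (0 : ℝ) 1, ∀ s ∈ closedBall (0 : ℂ) 1,
      (r : ℂ) * s ∈ ball (0 : ℂ) 1 := by
    intro r hr s hs
    have hs1 : ‖s‖ ≤ 1 := by simpa using hs
    rw [mem_ball_zero_iff, norm_mul, Complex.norm_real, norm_of_nonneg hr.1.le]
    nlinarith [hr.1, hr.2, norm_nonneg s]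
  have hne : ∀ ζ ∈ ball (0 : ℂ) 1, ∀ s ∈ sphere (0 : ℂ) 1, s - ζ ≠ 0 := by
    intro ζ hζ s hs h
    have h1 : ‖s‖ = 1 := by simpa using hs
    have h2 : ‖ζ‖ < 1 := by simpa using hζ
    rw [sub_eq_zero.1 h] at h1
    linarith
  have hker : ∀ ζ ∈ ball (0 : ℂ) 1,
      ContinuousOn (fun s : ℂ => (s + ζ) / (s - ζ)) (sphere 0 1) := fun ζ hζ =>
    ContinuousOn.div (by fun_prop) (by fun_prop) (hne ζ hζ)
  have hσ : ∀ r : ℝ, ∃ σ : FiniteMeasure (sphere (0 : ℂ) 1), r ∈ Set.Ioo (0 : ℝ) 1 →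
      (∫ _ : sphere (0 : ℂ) 1, (1 : ℂ) ∂(σ : Measure (sphere (0 : ℂ) 1)) = ((F 0).re : ℂ)) ∧
      ∀ ζ ∈ ball (0 : ℂ) 1, ∫ s : sphere (0 : ℂ) 1, ((s : ℂ) + ζ) / (s - ζ) ∂(σ : Measure (sphere (0 : ℂ) 1)) =
        F (r * ζ) - (F 0).im * I := by
    intro r
    by_cases hr : r ∈ Set.Ioo (0 : ℝ) 1
    swap
    · exact ⟨0, fun h => absurd h hr⟩
    have hd : DifferentiableOn ℂ (fun s : ℂ => F (r * s)) (closedBall 0 1) :=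
      hF.comp (by fun_prop) (hmaps r hr)
    have hdc : DiffContOnCl ℂ (fun s : ℂ => F (r * s)) (ball 0 1) :=
      DifferentiableOn.diffContOnCl (by rwa [closure_ball 0 one_ne_zero])
    obtain ⟨σ, hσ⟩ := exists_finiteMeasure_circle (h := fun s => (F (r * s)).re)
      (Complex.continuous_re.comp_continuousOn (hd.continuousOn.mono sphere_subset_closedBall))
      fun s hs => hpos _ (hmaps r hr s (sphere_subset_closedBall hs))
    have hform : ∀ ζ ∈ ball (0 : ℂ) 1,
        ∫ s : sphere (0 : ℂ) 1, ((s : ℂ) + ζ) / (s - ζ) ∂(σ : Measure (sphere (0 : ℂ) 1)) =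
          F (r * ζ) - (F 0).im * I := by
      intro ζ hζ
      have := circleAverage_schwarz hdc hζ
      rw [mul_zero] at this
      rw [← this]
      exact hσ _ (hker ζ hζ)
    refine ⟨σ, fun _ => ⟨?_, hform⟩⟩
    have h1 := hform 0 (by simp)
    have h2 : ∀ s : sphere (0 : ℂ) 1, ((s : ℂ) + 0) / (s - 0) = 1 := fun s => by
      rw [add_zero, sub_zero, div_self (ne_of_mem_sphere s.2 one_ne_zero)]
    simp_rw [h2] at h1
    rw [h1, mul_zero]
    nth_rewrite 1 [← Complex.re_add_im (F 0)]
    ring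
  choose σ hσ using hσ
  -- An ultrafilter finer than r → 1⁻ makes the measures converge by compactness, without passing to
  -- subsequences.
  let U : Ultrafilter ℝ := Ultrafilter.of (nhdsWithin 1 (Set.Iio 1))
  have hU : (U : Filter ℝ) ≤ nhdsWithin 1 (Set.Iio 1) := Ultrafilter.of_le _
  have hU0 : ∀ᶠ r in (U : Filter ℝ), r ∈ Set.Ioo (0 : ℝ) 1 :=
    hU (Ioo_mem_nhdsLT one_pos)
  have hcomp := isCompact_setOfPred_finiteMeasure_eq_of_compactSpace (sphere (0 : ℂ) 1) (F 0).re.toNNReal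
  have hmass : ∀ᶠ r in (U : Filter ℝ),
      σ r ∈ {μ : FiniteMeasure (sphere (0 : ℂ) 1) | μ.mass = (F 0).re.toNNReal} := by
    filter_upwards [hU0] with r hr
    have h1 := (hσ r hr).1
    rw [integral_const] at h1
    simp only [Complex.real_smul, mul_one, Complex.ofReal_inj] at h1
    change (σ r).mass = _
    rw [← h1]
    ext
    rw [Real.coe_toNNReal _ measureReal_nonneg]
    rfl
  obtain ⟨σ₀, -, hlim⟩ := hcomp.ultrafilter_le_nhds (U.map σ)
    (Filter.le_principal_iff.2 hmass)
  have hlim' : Filter.Tendsto σ U (nhds σ₀) := hlim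
  rw [FiniteMeasure.tendsto_iff_forall_integral_rclike_tendsto ℂ] at hlim'
  refine ⟨σ₀, fun ζ hζ => ?_⟩
  have hkc : Continuous fun s : sphere (0 : ℂ) 1 => ((s : ℂ) + ζ) / (s - ζ) :=
    (hker ζ hζ).comp_continuous continuous_subtype_val fun s => s.2
  have h1 := hlim' (BoundedContinuousFunction.mkOfCompact ⟨_, hkc⟩)
  have h2 : Filter.Tendsto (fun r : ℝ => F (r * ζ) - (F 0).im * I) U
      (nhds (F ζ - (F 0).im * I)) := by
    refine Filter.Tendsto.sub_const ?_ _
    have h3 : ContinuousAt F ((1 : ℝ) * ζ) := by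
      rw [Complex.ofReal_one, one_mul]
      exact (hF.differentiableAt (isOpen_ball.mem_nhds hζ)).continuousAt
    have h4 : Filter.Tendsto (fun r : ℝ => F (r * ζ)) (nhds 1) (nhds (F ((1 : ℝ) * ζ))) :=
      h3.tendsto.comp ((by fun_prop : Continuous fun r : ℝ => (r : ℂ) * ζ).tendsto 1)
    rw [Complex.ofReal_one, one_mul] at h4
    exact h4.mono_left (hU.trans nhdsWithin_le_nhds)
  have h5 : (fun r => ∫ s : sphere (0 : ℂ) 1, ((s : ℂ) + ζ) / (s - ζ) ∂(σ r : Measure (sphere (0 : ℂ) 1))) =ᶠ[U]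
      fun r : ℝ => F (r * ζ) - (F 0).im * I := by
    filter_upwards [hU0] with r hr using (hσ r hr).2 ζ hζ
  have h6 := tendsto_nhds_unique (h2.congr' h5.symm) h1
  rw [← sub_eq_iff_eq_add']
  exact h6

end LSys

/-! ### Nevanlinna representation and growth along the imaginary axis -/

namespace LSys

open Complex (I)
open MeasureTheory Metric

theorem im_cayley (ζ : ℂ) :
    (I * (1 + ζ) / (1 - ζ)).im = (1 - ‖ζ‖ ^ 2) / ‖1 - ζ‖ ^ 2 := by
  rw [← Complex.normSq_eq_norm_sq, ← Complex.normSq_eq_norm_sq, Complex.div_im, ← sub_div]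
  congr 1
  simp [Complex.normSq_apply]
  ring

theorem one_sub_ne_zero {ζ : ℂ} (hζ : ‖ζ‖ < 1) : 1 - ζ ≠ 0 := by
  intro h
  rw [← sub_eq_zero.1 h, norm_one] at hζ
  exact lt_irrefl _ hζ

theorem im_cayley_pos {ζ : ℂ} (hζ : ‖ζ‖ < 1) : 0 < (I * (1 + ζ) / (1 - ζ)).im := by
  rw [im_cayley]
  have := norm_pos_iff.2 (one_sub_ne_zero hζ)
  have : ‖ζ‖ ^ 2 < 1 := by nlinarith [norm_nonneg ζ]
  exact div_pos (by linarith) (by positivity)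

theorem add_I_ne_zero {z : ℂ} (hz : 0 < z.im) : z + I ≠ 0 := by
  intro h
  have := congrArg Complex.im h
  simp at this
  linarith

theorem norm_cayley_inv_lt_one {z : ℂ} (hz : 0 < z.im) : ‖(z - I) / (z + I)‖ < 1 := by
  rw [norm_div, div_lt_one (norm_pos_iff.2 (add_I_ne_zero hz))]
  refine lt_of_pow_lt_pow_left₀ 2 (norm_nonneg _) ?_
  rw [← Complex.normSq_eq_norm_sq, ← Complex.normSq_eq_norm_sq]
  simp only [Complex.normSq_apply, Complex.sub_re, Complex.sub_im, Complex.add_re, Complex.add_im,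
    Complex.I_re, Complex.I_im]
  nlinarith

theorem cayley_cayley_inv {z : ℂ} (hz : 0 < z.im) :
    I * (1 + (z - I) / (z + I)) / (1 - (z - I) / (z + I)) = z := by
  have h1 := add_I_ne_zero hz
  have h2 := one_sub_ne_zero (norm_cayley_inv_lt_one hz)
  rw [div_eq_iff h2]
  field_simp
  ring

/-- The Cayley transform of a point s ≠ 1 of the circle is real, so taking its real part loses
nothing; the rest is algebra. -/
theorem herglotz_kernel_eq {z s : ℂ} (hz : 0 < z.im) (hs : ‖s‖ = 1) (hs1 : s ≠ 1) :
    I * ((s + (z - I) / (z + I)) / (s - (z - I) / (z + I))) =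
      nevanlinnaKernel z (I * (1 + s) / (1 - s)).re := by
  have hre : (((I * (1 + s) / (1 - s)).re : ℝ) : ℂ) = I * (1 + s) / (1 - s) := by
    rw [Complex.ext_iff]
    refine ⟨by simp, ?_⟩
    rw [Complex.ofReal_im, im_cayley, hs]
    simp
  have h1 := add_I_ne_zero hz
  have h2 : 1 - s ≠ 0 := sub_ne_zero.2 hs1.symm
  have h3 : s - (z - I) / (z + I) ≠ 0 := by
    intro h
    have := norm_cayley_inv_lt_one hz
    rw [← sub_eq_zero.1 h, hs] at this
    exact lt_irrefl _ this
  have h4 := ofReal_sub_ne_zero hz (I * (1 + s) / (1 - s)).re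
  rw [nevanlinnaKernel]
  rw [hre] at h4 ⊢
  rw [← mul_div_assoc, div_eq_div_iff h3 h4]
  field_simp
  ring_nf
  simp only [Complex.I_sq, Complex.I_pow_three]
  ring

/-- The Nevanlinna representation theorem. -/
theorem exists_nevanlinna_measure {f : ℂ → ℂ} (hf : DifferentiableOn ℂ f {z | 0 < z.im})
    (hpos : ∀ z : ℂ, 0 < z.im → 0 ≤ (f z).im) : ∃ (b : ℝ) (σ : Measure ℝ), 0 ≤ b ∧
      IsFiniteMeasure σ ∧ ∀ z : ℂ, 0 < z.im →
        f z = (f I).re + b * z + ∫ t, nevanlinnaKernel z t ∂σ := by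
  obtain ⟨σ, hσ⟩ := exists_herglotz_measure
    (F := fun ζ => -I * f (I * (1 + ζ) / (1 - ζ))) (by
      refine DifferentiableOn.const_mul (hf.comp ?_ fun ζ hζ => ?_) _
      · exact DifferentiableOn.div (by fun_prop) (by fun_prop) fun ζ hζ =>
          one_sub_ne_zero (by simpa using hζ)
      · exact im_cayley_pos (by simpa using hζ)) (by
      intro ζ hζ
      simpa using hpos _ (im_cayley_pos (ζ := ζ) (by simpa using hζ)))
  -- The point 1 corresponds to t = ∞. The mass there becomes the linear coefficient b, and the rest
  -- of the measure is transported to the line.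
  let p : sphere (0 : ℂ) 1 := ⟨1, by simp⟩
  let T : sphere (0 : ℂ) 1 → ℝ := fun s => (I * (1 + s) / (1 - s)).re
  have hT : Measurable T := by fun_prop
  refine ⟨(σ : Measure (sphere (0 : ℂ) 1)).real {p},
    ((σ : Measure (sphere (0 : ℂ) 1)).restrict {p}ᶜ).map T, measureReal_nonneg, inferInstance,
    fun z hz => ?_⟩
  set ζ := (z - I) / (z + I) with hζ
  have hζ1 := norm_cayley_inv_lt_one hz
  have h1 := hσ ζ (mem_ball_zero_iff.2 hζ1)
  simp only [hζ, cayley_cayley_inv hz] at h1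
  simp only [add_zero, sub_zero, div_one, mul_one] at h1
  rw [← hζ] at h1
  have hcont : Continuous fun s : sphere (0 : ℂ) 1 => ((s : ℂ) + ζ) / (s - ζ) := by
    refine Continuous.div (by fun_prop) (by fun_prop) fun s h => ?_
    have h2 : ‖(s : ℂ)‖ = 1 := by simp
    rw [sub_eq_zero.1 h] at h2
    exact absurd h2 hζ1.ne
  have hint : Integrable (fun s : sphere (0 : ℂ) 1 => ((s : ℂ) + ζ) / (s - ζ))
      (σ : Measure (sphere (0 : ℂ) 1)) :=
    (BoundedContinuousFunction.mkOfCompact ⟨_, hcont⟩).integrable _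
  have h2 : ∫ s in {p}ᶜ, I * (((s : ℂ) + ζ) / (s - ζ)) ∂(σ : Measure (sphere (0 : ℂ) 1)) =
      ∫ t, nevanlinnaKernel z t ∂((σ : Measure (sphere (0 : ℂ) 1)).restrict {p}ᶜ).map T := by
    rw [integral_map hT.aemeasurable (by
      rw [show nevanlinnaKernel z = fun t : ℝ => z + (1 + z ^ 2) * ((t : ℂ) - z)⁻¹ from
        funext (nevanlinnaKernel_eq hz)]
      exact (continuous_const.add (continuous_const.mul
        (continuous_inv_ofReal_sub hz))).aestronglyMeasurable)]
    refine setIntegral_congr_fun (measurableSet_singleton p).compl fun s hs => ?_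
    exact herglotz_kernel_eq hz (by simp) fun h => hs (Subtype.ext h)
  rw [← h2, integral_const_mul]
  rw [← integral_add_compl (measurableSet_singleton p) hint, integral_singleton] at h1
  have h3 : ((p : ℂ) + ζ) / (p - ζ) = -I * z := by
    have h4 := cayley_cayley_inv hz
    rw [← hζ] at h4
    rw [← h4]
    change (1 + ζ) / (1 - ζ) = _
    linear_combination ((1 + ζ) / (1 - ζ)) * Complex.I_sq
  rw [h3, Complex.real_smul] at h1
  have h5 : f z = I * (-I * f z) := by linear_combination f z * Complex.I_sq
  rw [h5, h1]
  have h6 : (-I * f I).im = -(f I).re := by simp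
  rw [h6]
  push_cast
  linear_combination (-((f I).re : ℂ) - (σ : Measure (sphere (0 : ℂ) 1)).real {p} * z) * Complex.I_sq

/-- The density of `y Im V(iy)`. -/
theorem mul_im_nevanlinnaKernel {y : ℝ} (hy : 0 < y) (t : ℝ) :
    y * (nevanlinnaKernel (y * I) t).im = y ^ 2 * (1 + t ^ 2) / (t ^ 2 + y ^ 2) := by
  rw [nevanlinnaKernel, Complex.div_im]
  simp [Complex.normSq_apply]
  field_simp
  ring

theorem norm_nevanlinnaKernel_sq (y t : ℝ) :
    ‖nevanlinnaKernel (y * I) t‖ ^ 2 = (1 + t ^ 2 * y ^ 2) / (t ^ 2 + y ^ 2) := by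
  rw [nevanlinnaKernel, norm_div, div_pow, ← Complex.normSq_eq_norm_sq,
    ← Complex.normSq_eq_norm_sq]
  simp [Complex.normSq_apply]
  congr 1 <;> ring

theorem im_ofReal_mul_I_pos {y : ℝ} (hy : 0 < y) : 0 < ((y : ℂ) * I).im := by simpa using hy

theorem integrable_mul_im {σ : Measure ℝ} [IsFiniteMeasure σ] {y : ℝ} (hy : 0 < y) :
    Integrable (fun t : ℝ => y ^ 2 * (1 + t ^ 2) / (t ^ 2 + y ^ 2)) σ := by
  simp_rw [← mul_im_nevanlinnaKernel hy]
  exact (integrable_nevanlinnaKernel (im_ofReal_mul_I_pos hy)).im.const_mul y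

theorem mul_im_integral {σ : Measure ℝ} [IsFiniteMeasure σ] {y : ℝ} (hy : 0 < y) :
    y * (∫ t, nevanlinnaKernel (y * I) t ∂σ).im =
      ∫ t, y ^ 2 * (1 + t ^ 2) / (t ^ 2 + y ^ 2) ∂σ := by
  have h1 : (∫ t, nevanlinnaKernel (y * I) t ∂σ).im =
      ∫ t, (nevanlinnaKernel (y * I) t).im ∂σ :=
    (Complex.imCLM.integral_comp_comm
      (integrable_nevanlinnaKernel (im_ofReal_mul_I_pos hy))).symm
  rw [h1, ← integral_const_mul]
  simp_rw [mul_im_nevanlinnaKernel hy]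

/-- The integrands tend to 1 + t² as y → ∞, so a uniform bound on their integrals would contradict
Fatou's lemma. -/
theorem exists_le_mul_im {σ : Measure ℝ} [IsFiniteMeasure σ]
    (htop : ∫⁻ t, ENNReal.ofReal (1 + t ^ 2) ∂σ = ⊤) (N : ℝ) :
    ∃ y : ℝ, 1 ≤ y ∧ N ≤ ∫ t, y ^ 2 * (1 + t ^ 2) / (t ^ 2 + y ^ 2) ∂σ := by
  by_contra! hno
  have h1 : ∀ n : ℕ, ∫⁻ t, ENNReal.ofReal (((n : ℝ) + 1) ^ 2 * (1 + t ^ 2) /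
      (t ^ 2 + ((n : ℝ) + 1) ^ 2)) ∂σ ≤ ENNReal.ofReal N := by
    intro n
    rw [← ofReal_integral_eq_lintegral_ofReal (integrable_mul_im (by positivity))
      (.of_forall fun t => by positivity)]
    exact ENNReal.ofReal_le_ofReal (hno _ (by simp)).le
  have h2 : ∀ t : ℝ, Filter.Tendsto (fun n : ℕ => ENNReal.ofReal (((n : ℝ) + 1) ^ 2 * (1 + t ^ 2) /
      (t ^ 2 + ((n : ℝ) + 1) ^ 2))) Filter.atTop (nhds (ENNReal.ofReal (1 + t ^ 2))) := by
    intro t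
    refine (ENNReal.continuous_ofReal.tendsto _).comp ?_
    have h3 : Filter.Tendsto (fun n : ℕ => ((n : ℝ) + 1)) Filter.atTop Filter.atTop :=
      Filter.tendsto_atTop_add_const_right _ _ tendsto_natCast_atTop_atTop
    have h4 : Filter.Tendsto (fun n : ℕ => (((n : ℝ) + 1) ^ 2)⁻¹) Filter.atTop (nhds 0) :=
      tendsto_inv_atTop_zero.comp ((Filter.tendsto_pow_atTop two_ne_zero).comp h3)
    have h5 : Filter.Tendsto (fun n : ℕ => (1 + t ^ 2) / (t ^ 2 * (((n : ℝ) + 1) ^ 2)⁻¹ + 1))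
        Filter.atTop (nhds ((1 + t ^ 2) / (t ^ 2 * 0 + 1))) :=
      tendsto_const_nhds.div ((tendsto_const_nhds.mul h4).add tendsto_const_nhds) (by simp)
    rw [mul_zero, zero_add, div_one] at h5
    refine h5.congr fun n => ?_
    have : ((n : ℝ) + 1) ^ 2 ≠ 0 := by positivity
    field_simp
  have h6 := lintegral_liminf_le (μ := σ) (u := Filter.atTop)
    (f := fun (n : ℕ) (t : ℝ) => ENNReal.ofReal (((n : ℝ) + 1) ^ 2 * (1 + t ^ 2) /
      (t ^ 2 + ((n : ℝ) + 1) ^ 2))) (fun n => by fun_prop)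
  simp_rw [fun t => (h2 t).liminf_eq, htop] at h6
  have h7 : Filter.liminf (fun n : ℕ => ∫⁻ t, ENNReal.ofReal (((n : ℝ) + 1) ^ 2 * (1 + t ^ 2) /
      (t ^ 2 + ((n : ℝ) + 1) ^ 2)) ∂σ) Filter.atTop ≤ ENNReal.ofReal N :=
    Filter.liminf_le_of_le (by isBoundedDefault) fun b hb => by
      obtain ⟨n, hn⟩ := hb.exists
      exact hn.trans (h1 n)
  exact absurd (h6.trans h7) (by simp)

/-- For |t| ≤ R the kernel is bounded by 1 + R. On the tail, of mass at most ε, Cauchy–Schwarz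
applies, since |kernel|² is at most the integrand of y Im V(iy). With ε small, |V(iy)|² is thus
small compared with y Im V(iy), up to a constant. -/
theorem norm_integral_nevanlinnaKernel_le {σ : Measure ℝ} [IsFiniteMeasure σ] {ε R y : ℝ}
    (hε : 0 < ε) (hR : 0 ≤ R) (hy : 1 ≤ y) (hσ : σ.real {t | R < |t|} ≤ ε) :
    ‖∫ t, nevanlinnaKernel (y * I) t ∂σ‖ ≤ (1 + R) * σ.real Set.univ +
      √(ε * ∫ t, y ^ 2 * (1 + t ^ 2) / (t ^ 2 + y ^ 2) ∂σ) := by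
  have hy0 : 0 < y := one_pos.trans_le hy
  have hS : MeasurableSet {t : ℝ | R < |t|} := measurableSet_lt measurable_const measurable_id.abs
  have hint := integrable_nevanlinnaKernel (σ := σ) (im_ofReal_mul_I_pos hy0)
  have hJ := integrable_mul_im (σ := σ) hy0
  set S := {t : ℝ | R < |t|} with hSdef
  rw [← integral_add_compl hS hint, add_comm]
  refine (norm_add_le _ _).trans (add_le_add ?_ ?_)
  · have h1 : ∀ t ∈ Sᶜ, ‖nevanlinnaKernel (y * I) t‖ ≤ 1 + R := by
      intro t ht
      have ht' : |t| ≤ R := not_lt.1 ht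
      refine le_of_sq_le_sq ?_ (by positivity)
      rw [norm_nevanlinnaKernel_sq, div_le_iff₀ (by positivity)]
      have h2 : t ^ 2 ≤ R ^ 2 := sq_le_sq' (abs_le.1 ht').1 (abs_le.1 ht').2
      have h3 : 1 ≤ y ^ 2 := one_le_pow₀ hy
      nlinarith [mul_nonneg hR (sq_nonneg y), mul_nonneg hR (sq_nonneg t), sq_nonneg t,
        mul_nonneg (sq_nonneg R) (sq_nonneg t), mul_le_mul_of_nonneg_right h2 (sq_nonneg y)]
    refine (norm_setIntegral_le_of_norm_le_const (measure_lt_top σ _) h1).trans ?_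
    exact mul_le_mul_of_nonneg_left (measureReal_mono (Set.subset_univ _)) (by positivity)
  · set m := ∫ t in S, ‖nevanlinnaKernel (y * I) t‖ ∂σ
    refine (norm_integral_le_integral_norm _).trans (Real.le_sqrt_of_sq_le ?_)
    -- Cauchy–Schwarz by completing the square; dividing by ε instead of σ(S) also covers σ(S) = 0.
    have h1 : 0 ≤ ∫ t in S, (‖nevanlinnaKernel (y * I) t‖ - m / ε) ^ 2 ∂σ :=
      integral_nonneg fun t => sq_nonneg _
    have hle : ∀ t, ‖nevanlinnaKernel (y * I) t‖ ^ 2 ≤ y ^ 2 * (1 + t ^ 2) / (t ^ 2 + y ^ 2) := by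
      intro t
      rw [norm_nevanlinnaKernel_sq]
      gcongr
      nlinarith [one_le_pow₀ hy (n := 2)]
    have hi2 : Integrable (fun t => ‖nevanlinnaKernel (y * I) t‖ ^ 2) σ :=
      hJ.mono' (hint.1.norm.pow 2) (.of_forall fun t => by
        rw [Real.norm_of_nonneg (by positivity)]; exact hle t)
    have h2 : ∫ t in S, (‖nevanlinnaKernel (y * I) t‖ - m / ε) ^ 2 ∂σ =
        (∫ t in S, ‖nevanlinnaKernel (y * I) t‖ ^ 2 ∂σ) - 2 * (m / ε) * m +
          σ.real S * (m / ε) ^ 2 := by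
      have : ∀ t, (‖nevanlinnaKernel (y * I) t‖ - m / ε) ^ 2 =
          ‖nevanlinnaKernel (y * I) t‖ ^ 2 - 2 * (m / ε) * ‖nevanlinnaKernel (y * I) t‖ +
            (m / ε) ^ 2 := fun t => by ring
      simp_rw [this]
      have hi3 : Integrable (fun t => ‖nevanlinnaKernel (y * I) t‖ ^ 2 -
          2 * (m / ε) * ‖nevanlinnaKernel (y * I) t‖) (σ.restrict S) :=
        hi2.integrableOn.sub (hint.norm.integrableOn.const_mul _)
      rw [integral_add hi3 (integrable_const _), integral_sub hi2.integrableOn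
          (hint.norm.integrableOn.const_mul _), integral_const_mul, integral_const]
      simp only [measureReal_restrict_apply_univ, smul_eq_mul]
      rfl
    have h3 : ∫ t in S, ‖nevanlinnaKernel (y * I) t‖ ^ 2 ∂σ ≤
        ∫ t, y ^ 2 * (1 + t ^ 2) / (t ^ 2 + y ^ 2) ∂σ :=
      (setIntegral_mono hi2.integrableOn hJ.integrableOn hle).trans
        (setIntegral_le_integral hJ (.of_forall fun t => by positivity))
    have h4 : σ.real S * (m / ε) ^ 2 ≤ ε * (m / ε) ^ 2 :=
      mul_le_mul_of_nonneg_right hσ (sq_nonneg _)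
    have h5 : ε * (m / ε) ^ 2 = (m / ε) * m := by field_simp
    have h6 : m ^ 2 = ε * ((m / ε) * m) := by field_simp
    rw [h6]
    refine mul_le_mul_of_nonneg_left ?_ hε.le
    linarith

/-- For the functions in the Donoghue classes, `y (1 - |τ(iy)|²)` is unbounded, `τ` being the Cayley
transform. -/
theorem exists_mul_norm_sq_lt {σ : Measure ℝ} [IsFiniteMeasure σ]
    (htop : ∫⁻ t, ENNReal.ofReal (1 + t ^ 2) ∂σ = ⊤) (Q : ℝ) {B : ℝ} (hB : 0 < B) :
    ∃ y : ℝ, 1 ≤ y ∧ B * ‖Q + ∫ t, nevanlinnaKernel (y * I) t ∂σ + I‖ ^ 2 <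
      4 * (y * (∫ t, nevanlinnaKernel (y * I) t ∂σ).im) := by
  have hlim : Filter.Tendsto (fun n : ℕ => σ.real {t : ℝ | (n : ℝ) < |t|}) Filter.atTop
      (nhds 0) := by
    have h1 := tendsto_measure_iInter_atTop (μ := σ) (s := fun n : ℕ => {t : ℝ | (n : ℝ) < |t|})
      (fun n => (measurableSet_lt measurable_const measurable_id.abs).nullMeasurableSet)
      (fun m n hmn t (ht : (n : ℝ) < |t|) => (Nat.cast_le.2 hmn).trans_lt ht) ⟨0, measure_ne_top _ _⟩
    have h2 : ⋂ n : ℕ, {t : ℝ | (n : ℝ) < |t|} = ∅ := by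
      refine Set.eq_empty_of_forall_notMem fun t ht => ?_
      obtain ⟨n, hn⟩ := exists_nat_gt |t|
      exact lt_asymm hn (Set.mem_iInter.1 ht n)
    rw [h2, measure_empty] at h1
    exact (ENNReal.tendsto_toReal ENNReal.zero_ne_top).comp h1
  -- Tail mass 1/B cancels the factor B: the tail contributes at most 2J against the available 4J,
  -- and J > BC² absorbs the remaining 2BC².
  obtain ⟨n, hn⟩ := (hlim.eventually (ge_mem_nhds (show (0 : ℝ) < 1 / B by positivity))).exists
  set C := |Q| + 1 + (1 + n) * σ.real Set.univ with hC
  have hC1 : 1 ≤ C := by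
    have : 0 ≤ (1 + n) * σ.real Set.univ := by positivity
    have := abs_nonneg Q
    linarith
  obtain ⟨y, hy, hN⟩ := exists_le_mul_im htop (B * C ^ 2 + 1)
  have hy0 : 0 < y := one_pos.trans_le hy
  refine ⟨y, hy, ?_⟩
  rw [mul_im_integral hy0]
  set J := ∫ t, y ^ 2 * (1 + t ^ 2) / (t ^ 2 + y ^ 2) ∂σ
  have h1 := norm_integral_nevanlinnaKernel_le (σ := σ) (ε := 1 / B) (R := n) (by positivity)
    (by positivity) hy hn
  have hJ0 : 0 ≤ J := by nlinarith [sq_nonneg C]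
  have h2 : ‖Q + ∫ t, nevanlinnaKernel (y * I) t ∂σ + I‖ ≤ C + √(1 / B * J) := by
    refine (norm_add_le _ _).trans ?_
    refine (add_le_add (norm_add_le _ _) le_rfl).trans ?_
    rw [Complex.norm_real, Complex.norm_I, Real.norm_eq_abs]
    linarith
  have h3 : ‖Q + ∫ t, nevanlinnaKernel (y * I) t ∂σ + I‖ ^ 2 ≤ (C + √(1 / B * J)) ^ 2 :=
    pow_le_pow_left₀ (norm_nonneg _) h2 2
  have h4 : √(1 / B * J) ^ 2 = 1 / B * J := Real.sq_sqrt (by positivity)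
  have h5 : (C + √(1 / B * J)) ^ 2 ≤ 2 * C ^ 2 + 2 * (1 / B * J) := by
    nlinarith [sq_nonneg (C - √(1 / B * J))]
  have h6 : B * (2 * C ^ 2 + 2 * (1 / B * J)) = 2 * (B * C ^ 2) + 2 * J := by
    field_simp
  calc B * ‖Q + ∫ t, nevanlinnaKernel (y * I) t ∂σ + I‖ ^ 2
      ≤ B * (2 * C ^ 2 + 2 * (1 / B * J)) := mul_le_mul_of_nonneg_left (h3.trans h5) hB.le
    _ < 4 * J := by rw [h6]; linarith

/-- V + i = 2i/(1 − τ) and Im V = (1 − |τ|²)/|1 − τ|². This isolates a quantity that depends on |τ|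
only. -/
theorem four_mul_im_cayley {τ : ℂ} (hτ : ‖τ‖ < 1) :
    4 * (I * (1 + τ) / (1 - τ)).im = (1 - ‖τ‖ ^ 2) * ‖I * (1 + τ) / (1 - τ) + I‖ ^ 2 := by
  have h1 := one_sub_ne_zero hτ
  have h2 : I * (1 + τ) / (1 - τ) + I = 2 * I / (1 - τ) := by
    field_simp
    ring
  rw [im_cayley, h2, norm_div, norm_mul, Complex.norm_I]
  have h3 : ‖1 - τ‖ ≠ 0 := norm_ne_zero_iff.2 h1
  simp
  field_simp
  ring

end LSys

/-! ### Rotation invariance of the Donoghue classes -/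

namespace LSys

open Complex (I)
open MeasureTheory

/-- A function with unbounded `y (1 - |τ(iy)|²)` and a Nevanlinna representation has no linear term
and an infinite measure. -/
theorem mem_donoghue_of_unbounded {V : ℂ → ℂ} (hd : DifferentiableOn ℂ V {z | 0 < z.im})
    (hpos : ∀ z : ℂ, 0 < z.im → 0 ≤ (V z).im)
    (hunb : ∀ B : ℝ, 0 < B → ∃ y : ℝ, 1 ≤ y ∧
      B * ‖V (y * I) + I‖ ^ 2 < 4 * (y * (V (y * I)).im)) {Q a : ℝ} (hI : V I = Q + a * I) :
    V ∈ donoghue Q a := by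
  obtain ⟨b, σ, hb, hσ, hV⟩ := exists_nevanlinna_measure hd hpos
  have hre : (V I).re = Q := by simp [hI]
  rw [hre] at hV
  have him : ∀ y : ℝ, 0 < y → y * (V (y * I)).im =
      b * y ^ 2 + ∫ t, y ^ 2 * (1 + t ^ 2) / (t ^ 2 + y ^ 2) ∂σ := by
    intro y hy
    rw [hV _ (im_ofReal_mul_I_pos hy), ← mul_im_integral hy]
    simp
    ring
  have hnn : ∀ y : ℝ, 0 ≤ ∫ t, y ^ 2 * (1 + t ^ 2) / (t ^ 2 + y ^ 2) ∂σ := fun y =>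
    integral_nonneg fun t => by positivity
  have hnorm : ∀ y : ℝ, 0 < y → ((V (y * I)).im + 1) ^ 2 ≤ ‖V (y * I) + I‖ ^ 2 := by
    intro y hy
    have h1 := hpos _ (im_ofReal_mul_I_pos hy)
    have h2 := (le_abs_self _).trans (Complex.abs_im_le_norm (V (y * I) + I))
    rw [Complex.add_im, Complex.I_im] at h2
    exact pow_le_pow_left₀ (by linarith) h2 2
  -- A linear term b > 0 gives Im V(iy) ≥ by, which bounds 4y Im V(iy)/|V(iy) + i|² by 4/b.
  have hb0 : b = 0 := by
    by_contra hne
    have hb' : 0 < b := lt_of_le_of_ne hb (Ne.symm hne)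
    obtain ⟨y, hy, hlt⟩ := hunb (4 / b) (by positivity)
    have hy0 : 0 < y := one_pos.trans_le hy
    have h1 := hnorm y hy0
    have h2 := him y hy0
    have h3 := hnn y
    have h4 := hpos _ (im_ofReal_mul_I_pos hy0)
    set v := (V (y * I)).im
    have h5 : b * y ≤ v := by
      refine le_of_mul_le_mul_left ?_ hy0
      nlinarith
    have h6 : 4 / b * (v + 1) ^ 2 < 4 * (y * v) :=
      (mul_le_mul_of_nonneg_left h1 (by positivity)).trans_lt hlt
    rw [div_mul_eq_mul_div, div_lt_iff₀ hb'] at h6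
    nlinarith [mul_le_mul_of_nonneg_right h5 h4]
  have htop : ∫⁻ t, ENNReal.ofReal (1 + t ^ 2) ∂σ = ⊤ := by
    by_contra hne
    have hi : Integrable (fun t : ℝ => 1 + t ^ 2) σ := by
      refine ⟨by fun_prop, ?_⟩
      rw [hasFiniteIntegral_iff_ofReal (.of_forall fun t => by positivity)]
      exact lt_top_iff_ne_top.2 hne
    have hM : 0 ≤ ∫ t, (1 + t ^ 2) ∂σ := integral_nonneg fun t => by positivity
    -- With M = ∫(1 + t²) dσ finite, y Im V(iy) ≤ M while |V(iy) + i| ≥ 1, so the ratio is at most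
    -- 4M. The summand 1 keeps the constant positive.
    obtain ⟨y, hy, hlt⟩ := hunb (4 * ∫ t, (1 + t ^ 2) ∂σ + 1) (by positivity)
    have hy0 : 0 < y := one_pos.trans_le hy
    have h1 := hnorm y hy0
    have h2 := him y hy0
    have h4 := hpos _ (im_ofReal_mul_I_pos hy0)
    have h5 : ∫ t, y ^ 2 * (1 + t ^ 2) / (t ^ 2 + y ^ 2) ∂σ ≤ ∫ t, (1 + t ^ 2) ∂σ := by
      refine integral_mono (integrable_mul_im hy0) hi fun t => ?_
      simp only
      rw [div_le_iff₀ (by positivity)]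
      nlinarith [mul_nonneg (sq_nonneg t) (by positivity : 0 ≤ 1 + t ^ 2)]
    rw [h2, hb0] at hlt
    have h6 : 1 ≤ ‖V (y * I) + I‖ ^ 2 := (one_le_pow₀ (by linarith)).trans h1
    nlinarith [mul_le_mul_of_nonneg_left h6 hM]
  refine mem_donoghue_iff.2 ⟨σ, hσ, htop, ?_, fun z hz => ?_⟩
  · have h1 := hV I (by simp)
    rw [hI, hb0, integral_nevanlinnaKernel_I] at h1
    have := congrArg Complex.im h1
    simpa using this.symm
  · rw [hV z hz, hb0]; simp

/-- Rotation of the Cayley transform preserves the union of the Donoghue classes. -/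
theorem mem_donoghue_of_cayley {V V' τ : ℂ → ℂ} {c : ℂ} (hc : ‖c‖ = 1) {Q a Q' a' : ℝ}
    (hV : V ∈ donoghue Q a) (hτ : ∀ z : ℂ, 0 < z.im → ‖τ z‖ < 1)
    (hVτ : ∀ z : ℂ, 0 < z.im → V z = I * (1 + τ z) / (1 - τ z))
    (hV'τ : ∀ z : ℂ, 0 < z.im → V' z = I * (1 + c * τ z) / (1 - c * τ z))
    (hI : V' I = Q' + a' * I) : V' ∈ donoghue Q' a' := by
  obtain ⟨σ, hσ, htop, -, hVσ⟩ := mem_donoghue_iff.1 hV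
  have hcτ : ∀ z : ℂ, 0 < z.im → ‖c * τ z‖ < 1 := fun z hz => by
    rw [norm_mul, hc, one_mul]; exact hτ z hz
  have hVd : DifferentiableOn ℂ V {z | 0 < z.im} :=
    (differentiableOn_integral_nevanlinnaKernel (σ := σ)).const_add (Q : ℂ) |>.congr hVσ
  have hVpos : ∀ z : ℂ, 0 < z.im → 0 < (V z).im := fun z hz => by
    rw [hVτ z hz]; exact im_cayley_pos (hτ z hz)
  have hτV : ∀ z : ℂ, 0 < z.im → τ z = (V z - I) / (V z + I) := by
    intro z hz
    have h1 := one_sub_ne_zero (hτ z hz)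
    have h2 := add_I_ne_zero (hVpos z hz)
    rw [eq_div_iff h2, hVτ z hz]
    field_simp
    ring
  have hτd : DifferentiableOn ℂ τ {z | 0 < z.im} :=
    ((hVd.sub_const I).div (hVd.add_const I) fun z hz => add_I_ne_zero (hVpos z hz)).congr hτV
  have hV'd : DifferentiableOn ℂ V' {z | 0 < z.im} :=
    ((((hτd.const_mul c).const_add 1).const_mul I).div ((hτd.const_mul c).const_sub 1)
      fun z hz => one_sub_ne_zero (hcτ z hz)).congr hV'τ
  refine mem_donoghue_of_unbounded hV'd (fun z hz => ?_) (fun B hB => ?_) hI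
  · rw [hV'τ z hz]; exact (im_cayley_pos (hcτ z hz)).le
  · obtain ⟨y, hy, hlt⟩ := exists_mul_norm_sq_lt htop Q hB
    have hy0 : 0 < y := one_pos.trans_le hy
    have hz := im_ofReal_mul_I_pos hy0
    refine ⟨y, hy, ?_⟩
    have h1 := four_mul_im_cayley (hτ _ hz)
    have h2 := four_mul_im_cayley (hcτ _ hz)
    rw [← hVτ _ hz] at h1
    rw [← hV'τ _ hz, norm_mul, hc, one_mul] at h2
    have h3 : (V (y * I)).im = (∫ t, nevanlinnaKernel (y * I) t ∂σ).im := by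
      rw [hVσ _ hz]; simp
    rw [← hVσ _ hz, ← h3] at hlt
    have h4 : 0 < ‖V (y * I) + I‖ ^ 2 := by
      have := norm_pos_iff.2 (add_I_ne_zero (hVpos _ hz))
      positivity
    have hV'pos : 0 < (V' (y * I)).im := by rw [hV'τ _ hz]; exact im_cayley_pos (hcτ _ hz)
    have h5 : 0 < ‖V' (y * I) + I‖ ^ 2 := by
      have := norm_pos_iff.2 (add_I_ne_zero hV'pos)
      positivity
    -- The unimodular factor c has disappeared here, so the bound passes from V to V'.
    have h6 : B < y * (1 - ‖τ (y * I)‖ ^ 2) := by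
      refine lt_of_mul_lt_mul_right ?_ h4.le
      calc B * ‖V (y * I) + I‖ ^ 2 < 4 * (y * (V (y * I)).im) := hlt
        _ = y * (4 * (V (y * I)).im) := by ring
        _ = _ := by rw [h1]; ring
    calc B * ‖V' (y * I) + I‖ ^ 2
        < y * (1 - ‖τ (y * I)‖ ^ 2) * ‖V' (y * I) + I‖ ^ 2 := by gcongr
      _ = 4 * (y * (V' (y * I)).im) := by rw [mul_assoc, ← h2]; ring

/-- The points `-e^{2iα}`, `α ∈ [0, π)`, parametrize the unit circle. -/
theorem exists_neg_exp_eq {c : ℂ} (hc : ‖c‖ = 1) :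
    ∃ α ∈ Set.Ico 0 Real.pi, -Complex.exp (2 * I * (α : ℝ)) = c := by
  have hc' : ‖-c‖ = 1 := by rwa [norm_neg]
  set θ := toIcoMod Real.two_pi_pos 0 (-c).arg with hθ
  have h1 := toIcoMod_mem_Ico Real.two_pi_pos 0 (-c).arg
  rw [← hθ, zero_add] at h1
  refine ⟨θ / 2, ⟨by linarith [h1.1], by linarith [h1.2]⟩, ?_⟩
  have h2 : (-c).arg = θ + toIcoDiv Real.two_pi_pos 0 (-c).arg * (2 * Real.pi) := by
    have := toIcoMod_add_toIcoDiv_zsmul Real.two_pi_pos 0 (-c).arg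
    rw [zsmul_eq_mul] at this
    rw [hθ, this]
  have h3 := Complex.norm_mul_exp_arg_mul_I (-c)
  rw [hc', Complex.ofReal_one, one_mul, h2] at h3
  rw [neg_eq_iff_eq_neg, ← h3, Complex.exp_eq_exp_iff_exists_int]
  refine ⟨-toIcoDiv Real.two_pi_pos 0 (-c).arg, ?_⟩
  push_cast
  ring

theorem eq_of_exp_eq {α β : ℝ} (hα : α ∈ Set.Ico 0 Real.pi) (hβ : β ∈ Set.Ico 0 Real.pi)
    (h : Complex.exp (2 * I * α) = Complex.exp (2 * I * β)) : α = β := by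
  obtain ⟨n, hn⟩ := Complex.exp_eq_exp_iff_exists_int.1 h
  have h1 : α = β + n * Real.pi := by
    have h2 : ((α : ℝ) : ℂ) = ((β + n * Real.pi : ℝ) : ℂ) := by
      refine mul_left_cancel₀ (a := 2 * I) (by simp) ?_
      push_cast
      linear_combination hn
    exact_mod_cast h2
  have hpi := Real.pi_pos
  have h3 : (n : ℝ) < 1 := by
    by_contra hcon
    push Not at hcon
    nlinarith [hα.2, hβ.1]
  have h4 : (-1 : ℝ) < n := by
    by_contra hcon
    push Not at hcon
    nlinarith [hα.1, hβ.2]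
  have h5 : n = 0 := by
    have h6 : n < 1 := by exact_mod_cast h3
    have h7 : -1 < n := by exact_mod_cast h4
    omega
  rw [h1, h5]; simp

theorem norm_neg_exp (α : ℝ) : ‖-Complex.exp (2 * I * α)‖ = 1 := by
  rw [norm_neg, Complex.norm_exp]
  simp

theorem eq_cayley_inv {τ V : ℂ} (hτ : ‖τ‖ < 1) (hV : V = I * (1 + τ) / (1 - τ)) :
    τ = (V - I) / (V + I) := by
  have h1 := one_sub_ne_zero hτ
  have h2 : V + I ≠ 0 := add_I_ne_zero (by rw [hV]; exact im_cayley_pos hτ)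
  rw [eq_div_iff h2, hV]
  field_simp
  ring

/-! ### Unimodular transformations and the conclusion -/

section

variable {H : Type u} [NormedAddCommGroup H] [InnerProductSpace ℂ H] [CompleteSpace H]
  {A : H →ₗ.[ℂ] H} {H' : Type v} [NormedAddCommGroup H'] [InnerProductSpace ℂ H']
  [CompleteSpace H'] {A' : H' →ₗ.[ℂ] H'}

/-- The lower half-plane lies in both resolvent sets, so the transfer functions can be compared at
conj z, even for systems in different spaces. The factor is conjugated because W(conj z) = −conj
τ(z). -/
theorem ScalarLSystem.IsUnimodularTransformation.exists_cayley {Θ : ScalarLSystem A}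
    {Θ' : ScalarLSystem A'} {α : ℝ} (h : Θ.IsUnimodularTransformation α Θ') {z : ℂ}
    (hz : 0 < z.im) : ∃ τ : ℂ, ‖τ‖ < 1 ∧ Θ.impedance z = I * (1 + τ) / (1 - τ) ∧
      Θ'.impedance z = I * (1 + conj (-Complex.exp (2 * I * α)) * τ) /
        (1 - conj (-Complex.exp (2 * I * α)) * τ) := by
  obtain ⟨τ, h1, h2, h3⟩ := Θ.exists_cayley hz
  obtain ⟨τ', -, h5, h6⟩ := Θ'.exists_cayley hz
  have hz' : (conj z).im < 0 := by simpa using hz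
  have h7 := h.2 (conj z)
    ⟨Θ.mem_resolventSet_of_im_neg hz', Θ'.mem_resolventSet_of_im_neg hz'⟩
  rw [h3, h6] at h7
  have h8 : τ' = conj (-Complex.exp (2 * I * α)) * τ := by
    have := congrArg (starRingEnd ℂ) h7
    simp only [map_neg, map_mul, Complex.conj_conj] at this ⊢
    linear_combination -this
  exact ⟨τ, h1, h2, by rw [h5, h8]⟩

/-- Rotation keeps the function in some Donoghue class, so only V'(i) has to be computed, by
inverting the Cayley transform of the rotated value. -/
theorem ScalarLSystem.IsUnimodularTransformation.impedance_mem {Θ : ScalarLSystem A}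
    {Θ' : ScalarLSystem A'} {α : ℝ} (h : Θ.IsUnimodularTransformation α Θ') {Q a Q' a' : ℝ}
    (hV : Θ.impedance ∈ donoghue Q a) (hX : (Q' + a' * I + I : ℂ) ≠ 0)
    (hα : conj (-Complex.exp (2 * I * α)) * ((Q + a * I - I) / (Q + a * I + I)) =
      (Q' + a' * I - I) / (Q' + a' * I + I)) : Θ'.impedance ∈ donoghue Q' a' := by
  have hex : ∀ z : ℂ, ∃ τ : ℂ, 0 < z.im → ‖τ‖ < 1 ∧ Θ.impedance z = I * (1 + τ) / (1 - τ) ∧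
      Θ'.impedance z = I * (1 + conj (-Complex.exp (2 * I * α)) * τ) /
        (1 - conj (-Complex.exp (2 * I * α)) * τ) := by
    intro z
    by_cases hz : 0 < z.im
    · obtain ⟨τ, hτ⟩ := h.exists_cayley hz
      exact ⟨τ, fun _ => hτ⟩
    · exact ⟨0, fun h => absurd h hz⟩
  choose τ hτ using hex
  refine mem_donoghue_of_cayley (τ := τ) (c := conj (-Complex.exp (2 * I * α)))
    (by rw [RCLike.norm_conj, norm_neg_exp]) hV (fun z hz => (hτ z hz).1)
    (fun z hz => (hτ z hz).2.1) (fun z hz => (hτ z hz).2.2) ?_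
  obtain ⟨h1, h2, h3⟩ := hτ I (by simp)
  have h4 := eq_cayley_inv h1 h2
  rw [apply_I_of_mem_donoghue hV] at h4
  rw [h3, h4, hα]
  have h5 : 1 - (Q' + a' * I - I) / (Q' + a' * I + I) = 2 * I / (Q' + a' * I + I) := by
    rw [one_sub_div hX]; congr 1; ring
  have h6 : 1 + (Q' + a' * I - I) / (Q' + a' * I + I) =
      2 * (Q' + a' * I) / (Q' + a' * I + I) := by
    rw [one_add_div hX]; congr 1; ring
  rw [h5, h6, mul_div_assoc', div_div_div_cancel_right₀ hX]
  field_simp [Complex.I_ne_zero]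

theorem ScalarLSystem.IsUnimodularTransformation.conj_neg_exp_mul_eq {Θ : ScalarLSystem A}
    {Θ' : ScalarLSystem A'} {α : ℝ} (h : Θ.IsUnimodularTransformation α Θ') {Q a Q' a' : ℝ}
    (hV : Θ.impedance ∈ donoghue Q a) (hV' : Θ'.impedance ∈ donoghue Q' a') :
    conj (-Complex.exp (2 * I * α)) * ((Q + a * I - I) / (Q + a * I + I)) =
      (Q' + a' * I - I) / (Q' + a' * I + I) := by
  obtain ⟨τ, h1, h2, h3⟩ := h.exists_cayley (z := I) (by simp)
  have h4 := eq_cayley_inv h1 h2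
  have h5 := eq_cayley_inv (by rw [norm_mul, RCLike.norm_conj, norm_neg_exp, one_mul]; exact h1) h3
  rw [apply_I_of_mem_donoghue hV] at h4
  rw [apply_I_of_mem_donoghue hV'] at h5
  rw [← h4, h5]

theorem hasUniqueUnimodularTransformation (Θ : ScalarLSystem A) (hmin : Θ.IsMinimal) {Q a : ℝ}
    (hQ : Q ≠ 0) (hV : Θ.impedance ∈ donoghue Q a) :
    HasUniqueUnimodularTransformation.{u, v} Θ (donoghue (-Q) a) := by
  have hne : ∀ q b : ℝ, q ≠ 0 → (q + b * I : ℂ) ≠ 0 := by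
    intro q b hq h
    have := congrArg Complex.re h
    simp at this
    exact hq this
  have hp : ∀ q : ℝ, q ≠ 0 → (q + a * I + I : ℂ) ≠ 0 := fun q hq => by
    convert! hne q (a + 1) hq using 1
    push_cast; ring
  have hm : ∀ q : ℝ, q ≠ 0 → (q + a * I - I : ℂ) ≠ 0 := fun q hq => by
    convert! hne q (a - 1) hq using 1
    push_cast; ring
  have hQ' : -Q ≠ 0 := neg_ne_zero.2 hQ
  set τ₀ : ℂ := (Q + a * I - I) / (Q + a * I + I) with hτ₀
  set τ₁ : ℂ := (((-Q : ℝ) : ℂ) + a * I - I) / (((-Q : ℝ) : ℂ) + a * I + I) with hτ₁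
  have hτ₀0 : τ₀ ≠ 0 := div_ne_zero (hm Q hQ) (hp Q hQ)
  -- Changing the sign of Q reflects V(i) in the imaginary axis, which conjugates its Cayley
  -- transform. So τ₀ and τ₁ have equal modulus, and τ₁/τ₀ is a rotation.
  have hconj : conj τ₁ = τ₀ := by
    simp only [hτ₀, hτ₁, map_div₀, map_add, map_sub, map_mul, Complex.conj_ofReal, Complex.conj_I]
    rw [← neg_div_neg_eq]
    push_cast
    congr 1 <;> ring
  obtain ⟨α, hα, hαc⟩ := exists_neg_exp_eq (c := conj (τ₁ / τ₀)) (by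
    rw [RCLike.norm_conj, ← hconj, norm_div, RCLike.norm_conj]
    refine div_self (norm_ne_zero_iff.2 fun h => hτ₀0 ?_)
    rw [← hconj, h, map_zero])
  have hα' : conj (-Complex.exp (2 * I * α)) * τ₀ = τ₁ := by
    rw [hαc, Complex.conj_conj, div_mul_cancel₀ _ hτ₀0]
  obtain ⟨Θ₀, hT₀, hW₀⟩ := Θ.exists_rotate (norm_neg_exp α)
  have hΘ₀ : Θ.IsUnimodularTransformation α Θ₀ := ⟨hα, fun z hz => hW₀ z hz.1⟩
  refine ⟨α, hα, ⟨Θ₀, hT₀, hmin, hΘ₀, hΘ₀.impedance_mem hV (hp _ hQ') hα'⟩, ?_, ?_, ?_⟩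
  · intro H' _ _ _ A' Θ' h
    exact h.impedance_mem hV (hp _ hQ') hα'
  · intro H' _ _ _ A' Θ' α' h hV'
    have h1 := h.conj_neg_exp_mul_eq hV hV'
    refine eq_of_exp_eq h.1 hα (neg_injective ((starRingEnd ℂ).injective ?_))
    exact mul_right_cancel₀ hτ₀0 (h1.trans hα'.symm)
  · intro Θ₁ Θ₂ hT₁ hT₂ h₁ h₂
    -- The single point −i suffices: there W(−i) = −conj τ₀, which is non-zero because Q ≠ 0.
    have hz : (-I) ∈ resolventSet Θ.T := Θ.mem_resolventSet_of_im_neg (by simp)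
    have hz₁ : (-I) ∈ resolventSet Θ₁.T := by rwa [hT₁]
    have hz₂ : (-I) ∈ resolventSet Θ₂.T := by rwa [hT₂]
    have hW₁ := h₁.2 _ ⟨hz, hz₁⟩
    have hW₂ := h₂.2 _ ⟨hz, hz₂⟩
    refine ScalarLSystem.eq_of_transfer_eq Θ₁ Θ₂ (hT₁.trans hT₂.symm) hz₂ (hW₁.trans hW₂.symm) ?_
    rw [hW₂]
    refine mul_ne_zero ?_ (neg_ne_zero.2 (Complex.exp_ne_zero _))
    obtain ⟨τ, h1, h2, h3⟩ := Θ.exists_cayley (z := I) (by simp)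
    have h4 := eq_cayley_inv h1 h2
    rw [apply_I_of_mem_donoghue hV] at h4
    rw [Complex.conj_I] at h3
    rw [h3, h4]
    exact neg_ne_zero.2 ((map_ne_zero _).2 hτ₀0)

end

end LSys

theorem corollary5p6 {H : Type u} [NormedAddCommGroup H] [InnerProductSpace ℂ H]
    [CompleteSpace H] {A : H →ₗ.[ℂ] H} (Θ : LSys.ScalarLSystem A) (hmin : Θ.IsMinimal)
    (Q κ : ℝ) (hQ : Q ≠ 0) (hκ : κ ∈ Set.Ico 0 1) :
    (Θ.impedance ∈ LSys.classM Q →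
      LSys.HasUniqueUnimodularTransformation.{u, v} Θ (LSys.classM (-Q))) ∧
    (Θ.impedance ∈ LSys.classMk κ Q →
      LSys.HasUniqueUnimodularTransformation.{u, v} Θ (LSys.classMk κ (-Q))) ∧
    (Θ.impedance ∈ LSys.classMkInv κ Q →
      LSys.HasUniqueUnimodularTransformation.{u, v} Θ (LSys.classMkInv κ (-Q))) ∧
    (0 < κ →
      Disjoint (LSys.classM (-Q)) (LSys.classMk κ (-Q)) ∧
      Disjoint (LSys.classM (-Q)) (LSys.classMkInv κ (-Q)) ∧
      Disjoint (LSys.classMk κ (-Q)) (LSys.classMkInv κ (-Q))) := by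
  refine ⟨fun h => LSys.hasUniqueUnimodularTransformation Θ hmin hQ h,
    fun h => LSys.hasUniqueUnimodularTransformation Θ hmin hQ h,
    fun h => LSys.hasUniqueUnimodularTransformation Θ hmin hQ h, fun h0 => ?_⟩
  have h1 : κ < 1 := hκ.2
  have h2 : (1 - κ) / (1 + κ) < 1 := by rw [div_lt_one (by linarith)]; linarith
  have h3 : 1 < (1 + κ) / (1 - κ) := by rw [one_lt_div (by linarith)]; linarith
  -- The three normalizations are distinct for κ > 0, and each is read off from Im V(i).
  exact ⟨LSys.disjoint_donoghue h2.ne', LSys.disjoint_donoghue h3.ne,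
    LSys.disjoint_donoghue (h2.trans h3).ne⟩
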